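/- **Card guessing.** A Dealer holds a deck of $n$ cards. In each of $n$ turns the Dealer chooses a card that is still in the deck, the Guesser guesses which card it is, and then the card is revealed to the Guesser and discarded, and the guess is revealed to the Dealer. An *adaptive Dealer* is a map from transcript prefixes (the past guesses and draws) to probability distributions on the cards left in the deck; he does not see the Guesser's memory or randomness. A *Guesser with $m$ memory bits* has a memory state in $\{0,1\}^m$; her guess depends on her state, her next state depends on her state and the card drawn, and both may also depend on arbitrary, unlimited randomness, long lasting or fresh in every turn. **The Move-to-the-Back Dealer $D_m$.** Put $L=\lceil\log_2 n\rceil$, $\ell=mL$ and $k_1=\lfloor n/(\lceil 8e\rceil L)\rfloor$ (with $k_1=0$ if $L=0$). While more than $k_1$ cards are left, and again when at most $2\ell$ cards are left, $D_m$ draws a card uniformly from the deck. In between he plays consecutive epochs of $\ell$ turns, the first beginning when $k_1$ cards are left and the last being cut short when $2\ell$ cards are left. Each epoch begins with an empty set $B$ (the back of the deck). In each turn of an epoch he draws a card uniformly from $A\setminus B$, where $A$ is the set of cards left in the deck; if the card guessed in that turn is still in the deck after the draw, and $|B|<\ell$, it is then added to $B$. (If $k_1\le 2\ell$ there are no epochs.)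 **Theorem.** (1) The Dealers $D_m$ are efficient: a single random access machine program (with addition and truncated subtraction as its only arithmetic operations and every instruction counted as one step), given $n$, $m\le n$, the transcript of the turns played so far, and independent uniform random numbers $r_k\in\{0,\dots,k\}$ for $0\le k<n$, outputs in time polynomial in $n$ a card distributed exactly as the next draw of $D_m$. (2) There is an absolute constant $C$ such that for all integers $n\ge 2$ and $1\le m\le n$, every Guesser with $m$ memory bits, with arbitrary randomness, makes at most $$\ln m+2\ln\log_2 n+C$$ correct guesses in expectation in the game of $n$ turns against $D_m$. -/

import Mathlib

open scoped ENNReal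

namespace CardGame

/- ## The card guessing game -/

/-- A transcript prefix: the pairs (card guessed, card drawn) of the turns played so far, in
chronological order.  The deck is `Fin n`. -/
abbrev Transcript (n : ℕ) : Type := List (Fin n × Fin n)

/-- The cards that are still in the deck. -/
def available {n : ℕ} (h : Transcript n) : Finset (Fin n) :=
  Finset.univ.filter fun c => c ∉ h.map Prod.snd

/-- The number of correct guesses in a transcript. -/
def correct {n : ℕ} (h : Transcript n) : ℕ :=
  h.countP fun p => p.1 = p.2

/-- An adaptive Dealer for a deck of `n` cards: a choosing strategy, which maps a transcript prefix
to a distribution over the cards that are still in the deck. -/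
structure Dealer (n : ℕ) where
  draw : Transcript n → PMF (Fin n)
  legal : ∀ h : Transcript n, h.length < n → ∀ c ∈ (draw h).support, c ∈ available h

/-- A Guesser with `m` bits of memory, for a deck of `n` cards.  All her randomness is the outcome
`ω` in an arbitrary probability space `Ω`: it may hold long lasting random bits, which every call
may read again, and, for every turn `t`, fresh random bits for that turn.  Given `ω`, the guess is a
function of the turn and the memory state, and the next memory state is a function of the turn, the
memory state and the card drawn. -/
structure Guesser (Ω : Type*) [MeasurableSpace Ω] (n m : ℕ) where
  init : Ω → (Fin m → Bool)
  guess : Ω → ℕ → (Fin m → Bool) → Fin n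
  next : Ω → ℕ → (Fin m → Bool) → Fin n → (Fin m → Bool)
  measurable_init : Measurable init
  measurable_guess : ∀ t s, Measurable fun ω => guess ω t s
  measurable_next : ∀ t s c, Measurable fun ω => next ω t s c

/-- The joint distribution of the Guesser's memory state and the transcript after `t` turns, when
the Guesser's randomness is `ω`.  In each turn the Dealer draws a card, seeing only the transcript
of the earlier turns; the Guesser guesses, seeing only her memory state; then the card is revealed
to the Guesser and the guess to the Dealer. -/
noncomputable def play {Ω : Type*} [MeasurableSpace Ω] {n m : ℕ} (D : Dealer n)
    (G : Guesser Ω n m) (ω : Ω) : ℕ → PMF ((Fin m → Bool) × Transcript n)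
  | 0 => PMF.pure (G.init ω, [])
  | t + 1 => (play D G ω t).bind fun x =>
      (D.draw x.2).map fun c => (G.next ω t x.1 c, x.2 ++ [(G.guess ω t x.1, c)])

/-- The expected number of correct guesses in the whole game of `n` turns, over the randomness of
both players. -/
noncomputable def expectedCorrect {Ω : Type*} [MeasurableSpace Ω] {n m : ℕ}
    (P : MeasureTheory.Measure Ω) (D : Dealer n) (G : Guesser Ω n m) : ℝ≥0∞ :=
  ∫⁻ ω, ∑' x, play D G ω n x * (correct x.2 : ℝ≥0∞) ∂P

/- ## The Move-to-the-Back Dealer -/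

/-- One turn of an epoch.  The state is `(A, B)`: `A` is the set of cards in the deck, `B` the set of
cards that were moved to the back.  The drawn card `p.2` leaves `A`, and if the guessed card `p.1`
is still in the deck and fewer than `u` cards are at the back, it is moved to the back. -/
def mtbeStep {n : ℕ} (u : ℕ) (s : Finset (Fin n) × Finset (Fin n)) (p : Fin n × Fin n) :
    Finset (Fin n) × Finset (Fin n) :=
  let A := s.1.erase p.2
  (A, if p.1 ∈ A ∧ s.2.card < u then insert p.1 s.2 else s.2)

/-- The state `(A, B)` after the turns `e` of an epoch that began, with an empty back, when the
deck was `A`. -/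
def mtbeState {n : ℕ} (u : ℕ) (A : Finset (Fin n)) (e : Transcript n) :
    Finset (Fin n) × Finset (Fin n) :=
  e.foldl (mtbeStep u) (A, ∅)

/-- The set `A \ B` from which the next card is drawn, uniformly, in the epoch strategy. -/
def mtbeChoices {n : ℕ} (u : ℕ) (A : Finset (Fin n)) (e : Transcript n) : Finset (Fin n) :=
  (mtbeState u A e).1 \ (mtbeState u A e).2

/-- The length of an epoch: `m log n`, with the logarithm to base 2 rounded up. -/
def epochLength (n m : ℕ) : ℕ := m * Nat.clog 2 n

/-- The number of cards left when the first epoch begins: `n / (8 e log n)`, with `8 e` and `log n`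
rounded up and the quotient rounded down. -/
noncomputable def firstEpoch (n : ℕ) : ℕ := n / (⌈8 * Real.exp 1⌉₊ * Nat.clog 2 n)

/-- The set from which the Move-to-the-Back Dealer draws, uniformly, after the transcript `h`, when
`t = n - h.length` cards are left.  Let `k = firstEpoch n` and `ℓ = epochLength n m`.  For
`2 ℓ < t ≤ k` the epoch strategy is played, in consecutive epochs of `ℓ` turns (the last one is cut
short when `2 ℓ` cards are left), with at most `ℓ` cards at the back; before and afterwards a card is
drawn from the whole deck.  (If `k ≤ 2 ℓ`, there are no epochs: this is the random shuffle.) -/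
noncomputable def mtbChoices (n m : ℕ) (h : Transcript n) : Finset (Fin n) :=
  let t := n - h.length
  let k := firstEpoch n
  let l := epochLength n m
  if 2 * l < t ∧ t ≤ k then
    -- the number of turns of the game that precede the current epoch
    let s := (n - k) + (k - t) / l * l
    mtbeChoices l (available (h.take s)) (h.drop s)
  else available h

theorem mtbeState_spec {n : ℕ} (u : ℕ) (A : Finset (Fin n)) (e : Transcript n) :
    (∀ c, c ∈ (mtbeState u A e).1 ↔ c ∈ A ∧ c ∉ e.map Prod.snd) ∧
      (mtbeState u A e).2.card ≤ u := by
  induction e using List.reverseRecOn with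
  | nil => simp [mtbeState]
  | append_singleton e p ih =>
    have hs : mtbeState u A (e ++ [p]) = mtbeStep u (mtbeState u A e) p := by
      simp [mtbeState]
    rw [hs]
    refine ⟨fun c => ?_, ?_⟩
    · simp only [mtbeStep, Finset.mem_erase, ih.1, List.map_append, List.mem_append,
        List.map_cons, List.map_nil, List.mem_singleton]
      tauto
    · simp only [mtbeStep]
      split_ifs with hc
      · exact (Finset.card_insert_le _ _).trans hc.2
      · exact ih.2

theorem length_le_card_available {n : ℕ} (h : Transcript n) :
    n - h.length ≤ (available h).card := by
  have h1 : available h = (h.map Prod.snd).toFinsetᶜ := by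
    ext c; simp [available]
  rw [h1, Finset.card_compl, Fintype.card_fin]
  have h2 := List.toFinset_card_le (h.map Prod.snd)
  rw [List.length_map] at h2
  omega

theorem mtbChoices_spec {n m : ℕ} (h : Transcript n) (hn : h.length < n) :
    mtbChoices n m h ⊆ available h ∧ (mtbChoices n m h).Nonempty := by
  have hc := length_le_card_available h
  unfold mtbChoices
  simp only
  split_ifs with ht
  · generalize (n - firstEpoch n) + (firstEpoch n - (n - h.length)) / epochLength n m *
      epochLength n m = s
    obtain ⟨h1, h2⟩ := mtbeState_spec (epochLength n m) (available (h.take s)) (h.drop s)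
    have hA : (mtbeState (epochLength n m) (available (h.take s)) (h.drop s)).1 = available h := by
      ext c
      rw [h1]
      conv_rhs => rw [← List.take_append_drop s h]
      simp only [available, Finset.mem_filter, Finset.mem_univ, true_and, List.map_append,
        List.mem_append, not_or]
    refine ⟨?_, ?_⟩
    · rw [mtbeChoices, hA]; exact Finset.sdiff_subset
    · rw [mtbeChoices, hA, ← Finset.card_pos]
      have h3 := Finset.le_card_sdiff
        (mtbeState (epochLength n m) (available (h.take s)) (h.drop s)).2 (available h)
      omega
  · exact ⟨subset_rfl, Finset.card_pos.1 (by omega)⟩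

open Classical in
/-- The Move-to-the-Back Dealer for a deck of `n` cards and Guessers with `m` bits of memory.  (The
alternative in the definition of `draw` occurs only after the end of the game.) -/
noncomputable def mtbDealer (n m : ℕ) [NeZero n] : Dealer n where
  draw h := if hS : (mtbChoices n m h).Nonempty then PMF.uniformOfFinset _ hS else PMF.pure 0
  legal h hn c hc := by
    rw [dif_pos (mtbChoices_spec h hn).2, PMF.mem_support_uniformOfFinset_iff] at hc
    exact (mtbChoices_spec h hn).1 hc

/- ## Efficiency: random access machines with a step count -/

/-- The memory of a random access machine: natural number variables, and arrays. -/
structure Mem where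
  var : ℕ → ℕ
  arr : ℕ → ℕ → ℕ

def Mem.setVar (σ : Mem) (x v : ℕ) : Mem :=
  { σ with var := Function.update σ.var x v }

def Mem.setArr (σ : Mem) (a i v : ℕ) : Mem :=
  { σ with arr := Function.update σ.arr a (Function.update (σ.arr a) i v) }

/-- Programs of a random access machine.  Addition and truncated subtraction are the only arithmetic
operations, so that counting every instruction as one step is polynomially related to the running
time of a Turing machine. -/
inductive Prog : Type
  /-- `x := c` -/
  | const (x c : ℕ)
  /-- `x := y + z` -/
  | add (x y z : ℕ)
  /-- `x := y - z`, truncated at 0 -/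
  | sub (x y z : ℕ)
  /-- `x := a[y]` -/
  | load (x a y : ℕ)
  /-- `a[y] := x` -/
  | store (a y x : ℕ)
  /-- `p; q` -/
  | seq (p q : Prog)
  /-- `if x > 0 then p else q` -/
  | ite (x : ℕ) (p q : Prog)
  /-- `while x > 0 do p` -/
  | loop (x : ℕ) (p : Prog)

/-- `Exec p σ T τ`: started with memory `σ`, the program `p` halts after exactly `T` steps with
memory `τ`. -/
inductive Exec : Prog → Mem → ℕ → Mem → Prop
  | const (x c : ℕ) (σ : Mem) : Exec (.const x c) σ 1 (σ.setVar x c)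
  | add (x y z : ℕ) (σ : Mem) : Exec (.add x y z) σ 1 (σ.setVar x (σ.var y + σ.var z))
  | sub (x y z : ℕ) (σ : Mem) : Exec (.sub x y z) σ 1 (σ.setVar x (σ.var y - σ.var z))
  | load (x a y : ℕ) (σ : Mem) : Exec (.load x a y) σ 1 (σ.setVar x (σ.arr a (σ.var y)))
  | store (a y x : ℕ) (σ : Mem) : Exec (.store a y x) σ 1 (σ.setArr a (σ.var y) (σ.var x))
  | seq {p q : Prog} {σ τ υ : Mem} {S T : ℕ} (hp : Exec p σ S τ) (hq : Exec q τ T υ) :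
      Exec (.seq p q) σ (S + T) υ
  | ite_pos {x : ℕ} {p q : Prog} {σ τ : Mem} {T : ℕ} (hx : 0 < σ.var x) (hp : Exec p σ T τ) :
      Exec (.ite x p q) σ (T + 1) τ
  | ite_zero {x : ℕ} {p q : Prog} {σ τ : Mem} {T : ℕ} (hx : σ.var x = 0) (hq : Exec q σ T τ) :
      Exec (.ite x p q) σ (T + 1) τ
  | loop_pos {x : ℕ} {p : Prog} {σ τ υ : Mem} {S T : ℕ} (hx : 0 < σ.var x) (hp : Exec p σ S τ)
      (hq : Exec (.loop x p) τ T υ) : Exec (.loop x p) σ (S + T + 1) υ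
  | loop_zero {x : ℕ} {p : Prog} {σ : Mem} (hx : σ.var x = 0) : Exec (.loop x p) σ 1 σ

/-- The random numbers that a Dealer may use in one turn: for each `k < n`, a number from
`{0, …, k}`. -/
abbrev Seed (n : ℕ) : Type := (k : Fin n) → Fin (k.val + 1)

/-- The input of a Dealer's program in one turn: the numbers `n`, `m` and the number of turns played
so far in the variables 0, 1, 2; the past guesses, the past draws and the random numbers in the arrays
0, 1, 2; and 0 elsewhere. -/
def inputMem (n m : ℕ) (h : Transcript n) (r : Seed n) : Mem where
  var x := match x with
    | 0 => n
    | 1 => m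
    | 2 => h.length
    | _ => 0
  arr a i := match a with
    | 0 => (h[i]?).elim 0 fun p => p.1.val
    | 1 => (h[i]?).elim 0 fun p => p.2.val
    | 2 => if hi : i < n then (r ⟨i, hi⟩).val else 0
    | _ => 0

/-- A family of Dealers, for all `n` and `m`, is efficient if one program, in a number of steps
polynomial in `n`, computes in every turn of the game the card to draw (left in variable 0) from `n`,
`m`, the transcript so far, and independent uniform random numbers. -/
def Efficient (D : (n m : ℕ) → [NeZero n] → Dealer n) : Prop :=
  ∃ (p : Prog) (b : Polynomial ℕ), ∀ (n m : ℕ) [NeZero n], m ≤ n →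
    ∀ h : Transcript n, h.length < n → (h.map Prod.snd).Nodup →
      ∃ f : Seed n → Fin n,
        (∀ r : Seed n, ∃ (T : ℕ) (τ : Mem),
          Exec p (inputMem n m h r) T τ ∧ T ≤ b.eval n ∧ τ.var 0 = (f r).val) ∧
        (PMF.uniformOfFintype (Seed n)).map f = (D n m).draw h

end CardGame

/-!
The Guesser's randomness plays no role in the upper bound, which holds for every outcome `ω`, so
that her guess and her next memory state are functions. Write `L = ⌈log₂ n⌉`, `ℓ = m * L`, and
call a guess a *hit* if it lies in the set `mtbChoices` from which the Dealer draws.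

Outside of the epochs, and in the epochs that begin with fewer than `4 ℓ` cards, the trivial
bounds on the probability of a correct guess, `1 / t` with `t` cards left and `1 / ℓ`, add up to
`log m + 2 * log L + O(1)`. In the other epochs only a hit can be correct, and a card that was hit
moves out of the set of choices. So it suffices that an epoch has at most `2 * m` hits in
expectation (`sum_hitProb_le`): if it begins with `t` cards, it then contributes at most `2 * m /
(t - 2 * ℓ)`, and the sum of these terms over the epochs is at most `(2 / L) * log n = O(1)`.

The bound on the hits compares the Move-to-the-Back Dealer with a uniform shuffle. In a uniform
shuffle, a Guesser who starts the epoch in a fixed memory state is asking for elements of a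
uniformly random `t`-subset of the deck, so that `z` to the number of hits has expectation at most
`(1 + p * (z - 1)) ^ ℓ` with `p` about `t / n` (`sum_hitPotential_le`); summing over the memory
states costs a factor of `2 ^ m`. The deck that the Dealer really has at the beginning of the
epoch is not uniform, because earlier guesses influenced it, but by Jensen's inequality the
comparison costs just the relative entropy (`log_mul_sum_hitProb_le`). An earlier epoch that began
with `t'` cards contributes at most `ℓ / (t' - 2 * ℓ)` times its number of hits to it
(`sum_drawCost_le`). By induction the entropy is at most `2 * m * log (2 * k / t)`, where `k` is
the number of cards at the beginning of the first epoch. On the other side of the inequality every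
hit counts `log z`, and `z = n / (L * t)` gives `log z ≥ log 11 + log (2 * k / t)`, because `22 *
L * k ≤ n`; so the induction closes.

For the efficiency, the Dealer draws uniformly from the cards that are in the deck and were not
guessed in the current epoch (`mtbChoices_eq`); the bound on the size of the back has an effect
only if `ℓ = 0`, when the back is always empty. The program marks the other cards, counts the `q`
cards that are left, and outputs the one that has `r` unmarked cards below it, where `r` is the
given random number in `{0, …, q - 1}`.
-/

namespace CardGame

/-! ### Expectations along the game -/

section Expect

variable {Ω : Type*} [MeasurableSpace Ω] {n m : ℕ}

/-- The state after turn `t`, when the card `c` is drawn in state `x`. -/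
def after (G : Guesser Ω n m) (ω : Ω) (t : ℕ) (x : (Fin m → Bool) × Transcript n) (c : Fin n) :
    (Fin m → Bool) × Transcript n :=
  (G.next ω t x.1 c, x.2 ++ [(G.guess ω t x.1, c)])

/-- The conditional expectation of `F`, a function of the state after turn `t`, given the state
before that turn. -/
noncomputable def turn (D : Dealer n) (G : Guesser Ω n m) (ω : Ω) (t : ℕ)
    (F : (Fin m → Bool) × Transcript n → ℝ) (x : (Fin m → Bool) × Transcript n) : ℝ :=
  ∑ c, (D.draw x.2 c).toReal * F (after G ω t x c)

/-- The expectation of `F` of the state after `t` turns, for the outcome `ω` of the Guesser's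
randomness.  It is a finite sum, so that real values need no integrability. -/
noncomputable def expect (D : Dealer n) (G : Guesser Ω n m) (ω : Ω) :
    ℕ → ((Fin m → Bool) × Transcript n → ℝ) → ℝ
  | 0, F => F (G.init ω, [])
  | t + 1, F => expect D G ω t (turn D G ω t F)

theorem tsum_bind_mul {α β : Type*} (p : PMF α) (f : α → PMF β) (g : β → ℝ≥0∞) :
    ∑' y, p.bind f y * g y = ∑' x, p x * ∑' y, f x y * g y := by
  simp only [PMF.bind_apply, ← ENNReal.tsum_mul_right, ← ENNReal.tsum_mul_left, mul_assoc]
  exact ENNReal.tsum_comm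

theorem tsum_map_mul {α β : Type*} (p : PMF α) (f : α → β) (g : β → ℝ≥0∞) :
    ∑' y, p.map f y * g y = ∑' x, p x * g (f x) := by
  classical
  rw [PMF.map, tsum_bind_mul]
  refine tsum_congr fun x => ?_
  rw [tsum_eq_single (f x)]
  · simp
  · intro y hy; simp [hy]

variable (D : Dealer n) (G : Guesser Ω n m) (ω : Ω)

theorem tsum_play_mul (t : ℕ) (F : (Fin m → Bool) × Transcript n → ℝ) (hF : ∀ x, 0 ≤ F x) :
    ∑' x, play D G ω t x * ENNReal.ofReal (F x) = ENNReal.ofReal (expect D G ω t F) := by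
  induction t generalizing F with
  | zero =>
    rw [play, expect, tsum_eq_single (G.init ω, [])]
    · simp
    · intro y hy; simp [hy]
  | succ t ih =>
    have h0 : ∀ x c, 0 ≤ (D.draw x.2 c).toReal * F (after G ω t x c) := fun x c =>
      mul_nonneg ENNReal.toReal_nonneg (hF _)
    rw [play, expect, ← ih (turn D G ω t F) fun x => Finset.sum_nonneg fun c _ => h0 x c,
      tsum_bind_mul]
    refine tsum_congr fun x => ?_
    rw [tsum_map_mul, tsum_fintype, turn, ENNReal.ofReal_sum_of_nonneg fun c _ => h0 x c]
    congr 1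
    refine Finset.sum_congr rfl fun c _ => ?_
    rw [ENNReal.ofReal_mul ENNReal.toReal_nonneg, ENNReal.ofReal_toReal (PMF.apply_ne_top _ _)]
    rfl

theorem sum_draw (h : Transcript n) : ∑ c, (D.draw h c).toReal = 1 := by
  have h1 := (D.draw h).tsum_coe
  rw [tsum_fintype] at h1
  rw [← ENNReal.toReal_sum fun c _ => PMF.apply_ne_top _ _, h1, ENNReal.toReal_one]

theorem turn_add (t : ℕ) (F F' : (Fin m → Bool) × Transcript n → ℝ) :
    turn D G ω t (fun x => F x + F' x) = fun x => turn D G ω t F x + turn D G ω t F' x := by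
  funext x; simp only [turn, mul_add, Finset.sum_add_distrib]

theorem expect_add (t : ℕ) (F F' : (Fin m → Bool) × Transcript n → ℝ) :
    expect D G ω t (fun x => F x + F' x) = expect D G ω t F + expect D G ω t F' := by
  induction t generalizing F F' with
  | zero => rfl
  | succ t ih => rw [expect, turn_add, ih]; rfl

theorem expect_const_mul (t : ℕ) (a : ℝ) (F : (Fin m → Bool) × Transcript n → ℝ) :
    expect D G ω t (fun x => a * F x) = a * expect D G ω t F := by
  induction t generalizing F with
  | zero => rfl
  | succ t ih =>
    rw [expect, expect, ← ih]
    congr 1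
    funext x
    simp only [turn, Finset.mul_sum, mul_left_comm]

theorem expect_const (t : ℕ) (a : ℝ) : expect D G ω t (fun _ => a) = a := by
  induction t with
  | zero => rfl
  | succ t ih =>
    rw [expect]
    conv_rhs => rw [← ih]
    congr 1
    funext x
    rw [turn, ← Finset.sum_mul, sum_draw, one_mul]

/-- The transcripts that can occur after `t` turns: no card is drawn twice. -/
def Legal (t : ℕ) (h : Transcript n) : Prop := h.length = t ∧ (h.map Prod.snd).Nodup

theorem Legal.append {t : ℕ} {h : Transcript n} (hh : Legal t h) (g : Fin n) {c : Fin n}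
    (hc : c ∈ available h) : Legal (t + 1) (h ++ [(g, c)]) := by
  refine ⟨by simp [hh.1], ?_⟩
  rw [List.map_append, List.nodup_append]
  simp only [available, Finset.mem_filter, Finset.mem_univ, true_and] at hc
  refine ⟨hh.2, by simp, ?_⟩
  rintro a ha b hb rfl
  simp only [List.map_cons, List.map_nil, List.mem_singleton] at hb
  exact hc (hb ▸ ha)

theorem Legal.card_available {t : ℕ} {h : Transcript n} (hh : Legal t h) :
    (available h).card = n - t := by
  have h1 : available h = (h.map Prod.snd).toFinsetᶜ := by
    ext c; simp [available]
  rw [h1, Finset.card_compl, Fintype.card_fin, List.toFinset_card_of_nodup hh.2, List.length_map,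
    hh.1]

theorem available_append (h : Transcript n) (p : Fin n × Fin n) :
    available (h ++ [p]) = (available h).erase p.2 := by
  ext c
  simp only [available, List.map_append, List.mem_append, List.map_cons, List.map_nil,
    List.mem_singleton, Finset.mem_filter, Finset.mem_univ, true_and, Finset.mem_erase]
  tauto

theorem expect_mono {t : ℕ} (ht : t ≤ n) {F F' : (Fin m → Bool) × Transcript n → ℝ}
    (hF : ∀ x, Legal t x.2 → F x ≤ F' x) : expect D G ω t F ≤ expect D G ω t F' := by
  induction t generalizing F F' with
  | zero => exact hF _ ⟨rfl, by simp⟩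
  | succ t ih =>
    refine ih (by omega) fun x hx => Finset.sum_le_sum fun c _ => ?_
    by_cases hc : c ∈ (D.draw x.2).support
    · exact mul_le_mul_of_nonneg_left
        (hF _ (hx.append _ (D.legal x.2 (by rw [hx.1]; omega) c hc))) ENNReal.toReal_nonneg
    · rw [PMF.mem_support_iff, not_not] at hc
      simp [hc]

theorem expect_congr {t : ℕ} (ht : t ≤ n) {F F' : (Fin m → Bool) × Transcript n → ℝ}
    (hF : ∀ x, Legal t x.2 → F x = F' x) : expect D G ω t F = expect D G ω t F' :=
  le_antisymm (expect_mono D G ω ht fun x hx => (hF x hx).le)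
    (expect_mono D G ω ht fun x hx => (hF x hx).ge)

/-- The expected number of correct guesses is the sum over the turns of the probability that the
Dealer draws the guessed card. -/
theorem expect_correct (t : ℕ) :
    expect D G ω t (fun x => (correct x.2 : ℝ)) =
      ∑ i ∈ Finset.range t, expect D G ω i fun x => (D.draw x.2 (G.guess ω i x.1)).toReal := by
  induction t with
  | zero => simp [expect, correct]
  | succ t ih =>
    rw [Finset.sum_range_succ, ← ih, ← expect_add, expect]
    congr 1
    funext x
    have h1 : ∀ c, (correct (after G ω t x c).2 : ℝ) =
        correct x.2 + if G.guess ω t x.1 = c then 1 else 0 := by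
      intro c
      simp only [after, correct, List.countP_append, List.countP_singleton, decide_eq_true_eq]
      split_ifs <;> simp
    simp only [turn, h1, mul_add, Finset.sum_add_distrib, ← Finset.sum_mul, sum_draw, one_mul]
    simp

end Expect

/-! ### Guessing inside an unknown random set -/

section Potential

/-- Drawing a card from a `v`-subset of `U` and then looking at the rest of it is the same as
choosing the card first and then a `(v-1)`-subset of the other elements of `U`. -/
theorem sum_powersetCard_sum_erase {α : Type*} [DecidableEq α] (U : Finset α) (v : ℕ)
    (φ : α → Finset α → ℝ) :
    ∑ S ∈ U.powersetCard (v + 1), ∑ d ∈ S, φ d (S.erase d) =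
      ∑ d ∈ U, ∑ S ∈ (U.erase d).powersetCard v, φ d S := by
  rw [Finset.sum_sigma', Finset.sum_sigma']
  refine Finset.sum_bij' (fun x _ => ⟨x.2, x.1.erase x.2⟩) (fun x _ => ⟨insert x.1 x.2, x.1⟩)
    ?_ ?_ ?_ ?_ ?_
  · rintro ⟨S, d⟩ h
    simp only [Finset.mem_sigma, Finset.mem_powersetCard] at h ⊢
    obtain ⟨⟨h1, h2⟩, h3⟩ := h
    exact ⟨h1 h3, Finset.erase_subset_erase d h1, by rw [Finset.card_erase_of_mem h3, h2]; rfl⟩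
  · rintro ⟨d, S⟩ h
    simp only [Finset.mem_sigma, Finset.mem_powersetCard] at h ⊢
    obtain ⟨h1, h2, h3⟩ := h
    have hd : d ∉ S := fun hd => by simpa using h2 hd
    exact ⟨⟨Finset.insert_subset h1 (h2.trans (Finset.erase_subset _ _)),
      by rw [Finset.card_insert_of_notMem hd, h3]⟩, Finset.mem_insert_self _ _⟩
  · rintro ⟨S, d⟩ h
    simp only [Finset.mem_sigma] at h
    simp [Finset.insert_erase h.2]
  · rintro ⟨d, S⟩ h
    simp only [Finset.mem_sigma, Finset.mem_powersetCard] at h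
    obtain ⟨h1, h2, h3⟩ := h
    have hd : d ∉ S := fun hd => by simpa using h2 hd
    simp [Finset.erase_insert hd]
  · rintro ⟨S, d⟩ h
    rfl

variable {Ω : Type*} [MeasurableSpace Ω] {n m : ℕ} (G : Guesser Ω n m) (ω : Ω)

/-- The expectation of `z` to the number of hits in the next `j` turns, when the Guesser is in
memory state `s` before turn `t` and the Dealer, in each turn, draws uniformly from `S` and then
removes the card drawn and the card guessed from `S`.  A hit is a guess in `S`. -/
noncomputable def hitPotential (z : ℝ) : ℕ → ℕ → (Fin m → Bool) → Finset (Fin n) → ℝ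
  | 0, _, _, _ => 1
  | j + 1, t, s, S => (if G.guess ω t s ∈ S then z else 1) * ((S.card : ℝ)⁻¹ *
      ∑ d ∈ S, hitPotential z j (t + 1) (G.next ω t s d) ((S.erase d).erase (G.guess ω t s)))

theorem hitPotential_nonneg {z : ℝ} (hz : 0 ≤ z) (j t : ℕ) (s : Fin m → Bool)
    (S : Finset (Fin n)) : 0 ≤ hitPotential G ω z j t s S := by
  induction j generalizing t s S with
  | zero => simp [hitPotential]
  | succ j ih =>
    rw [hitPotential]
    have : 0 ≤ ∑ d ∈ S, hitPotential G ω z j (t + 1) (G.next ω t s d)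
        ((S.erase d).erase (G.guess ω t s)) := Finset.sum_nonneg fun d _ => ih _ _ _
    split_ifs <;> positivity

theorem sum_erase_card_choose {α : Type*} [DecidableEq α] (U : Finset α) (v : ℕ) :
    ∑ d ∈ U, ((U.erase d).card.choose v : ℝ) = (v + 1) * U.card.choose (v + 1) := by
  rw [Finset.sum_congr rfl fun d hd => by rw [Finset.card_erase_of_mem hd], Finset.sum_const,
    nsmul_eq_mul]
  rcases hU : U.card with _ | u
  · simp
  · have := Nat.add_one_mul_choose_eq u v
    rw [Nat.add_sub_cancel]
    rw [mul_comm ((v : ℝ) + 1)]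
    exact_mod_cast this

/-- The Guesser starts in a fixed memory state and knows nothing about the uniformly random
`v`-subset `S` of `U` but what she learns on the way.  As long as at most a fraction `p` of the
cards that she has not asked about are in `S`, each guess multiplies the potential by a factor of
at most `1 + p * (z - 1)`. -/
theorem sum_hitPotential_le {z p : ℝ} (hz : 1 ≤ z) (hp : 0 ≤ p) (j t : ℕ) (s : Fin m → Bool)
    (U : Finset (Fin n)) (v : ℕ) (hv : (v : ℝ) ≤ p * (U.card - 2 * j)) :
    ∑ S ∈ U.powersetCard v, hitPotential G ω z j t s S ≤
      (1 + p * (z - 1)) ^ j * U.card.choose v := by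
  have hq : 0 ≤ 1 + p * (z - 1) := by nlinarith
  induction j generalizing t s U v with
  | zero => simp [hitPotential]
  | succ j ih =>
    set g := G.guess ω t s with hg
    have hpj := pow_nonneg hq j
    rcases v with _ | v
    · simp only [Finset.powersetCard_zero, Finset.sum_singleton, hitPotential, Finset.sum_empty,
        mul_zero, Nat.choose_zero_right]
      positivity
    -- one draw, when the guess is known to be outside of `S`
    have key : ∀ W : Finset (Fin n), g ∉ W → (v : ℝ) ≤ p * ((W.card : ℝ) - 1 - 2 * j) →
        ∑ S ∈ W.powersetCard (v + 1), hitPotential G ω z (j + 1) t s S ≤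
          (1 + p * (z - 1)) ^ j * W.card.choose (v + 1) := by
      intro W hgW hvW
      have h1 : ∀ S ∈ W.powersetCard (v + 1), hitPotential G ω z (j + 1) t s S =
          ((v : ℝ) + 1)⁻¹ * ∑ d ∈ S, hitPotential G ω z j (t + 1) (G.next ω t s d)
            (S.erase d) := by
        intro S hS
        rw [Finset.mem_powersetCard] at hS
        have hgS : g ∉ S := fun h => hgW (hS.1 h)
        rw [hitPotential, if_neg hgS, one_mul, hS.2]
        push_cast
        congr 1
        refine Finset.sum_congr rfl fun d _ => ?_
        rw [Finset.erase_eq_of_notMem (a := g)]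
        exact fun h => hgS (Finset.mem_of_mem_erase h)
      rw [Finset.sum_congr rfl h1, ← Finset.mul_sum, sum_powersetCard_sum_erase W v
        fun d S => hitPotential G ω z j (t + 1) (G.next ω t s d) S]
      calc _ ≤ ((v : ℝ) + 1)⁻¹ * ∑ d ∈ W, (1 + p * (z - 1)) ^ j * (W.erase d).card.choose v := by
            refine mul_le_mul_of_nonneg_left (Finset.sum_le_sum fun d hd => ih _ _ _ _ ?_)
              (by positivity)
            rw [Finset.card_erase_of_mem hd, Nat.cast_sub (Finset.card_pos.2 ⟨d, hd⟩)]
            push_cast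
            exact hvW
        _ = _ := by
            rw [← Finset.mul_sum, sum_erase_card_choose]
            field_simp
    push_cast at hv
    by_cases hgU : g ∈ U
    swap
    · refine (key U hgU (by nlinarith)).trans ?_
      rw [pow_succ]
      exact mul_le_mul_of_nonneg_right (le_mul_of_one_le_right hpj (by nlinarith)) (by positivity)
    obtain ⟨W, hgW, rfl⟩ : ∃ W, g ∉ W ∧ U = insert g W :=
      ⟨U.erase g, by simp, (Finset.insert_erase hgU).symm⟩
    rw [Finset.card_insert_of_notMem hgW] at hv ⊢
    push_cast at hv
    rw [Finset.powersetCard_succ_insert hgW, Finset.sum_union]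
    swap
    · rw [Finset.disjoint_left]
      intro S hS hS'
      rw [Finset.mem_powersetCard] at hS
      obtain ⟨S', -, rfl⟩ := Finset.mem_image.1 hS'
      exact hgW (hS.1 (Finset.mem_insert_self _ _))
    rw [Finset.sum_image]
    swap
    · intro S hS S' hS' h
      rw [Finset.mem_coe, Finset.mem_powersetCard] at hS hS'
      have e1 : g ∉ S := fun h => hgW (hS.1 h)
      have e2 : g ∉ S' := fun h => hgW (hS'.1 h)
      rw [← Finset.erase_insert e1, ← Finset.erase_insert e2]
      exact congrArg (fun A => Finset.erase A g) h
    -- one draw, when the guess is a hit: either the card guessed is drawn, or another card is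
    have hit : ∑ S ∈ W.powersetCard v, hitPotential G ω z (j + 1) t s (insert g S) ≤
        z * ((1 + p * (z - 1)) ^ j * W.card.choose v) := by
      have h1 : ∀ S ∈ W.powersetCard v, hitPotential G ω z (j + 1) t s (insert g S) =
          z * (((v : ℝ) + 1)⁻¹ * (hitPotential G ω z j (t + 1) (G.next ω t s g) S +
            ∑ d ∈ S, hitPotential G ω z j (t + 1) (G.next ω t s d) (S.erase d))) := by
        intro S hS
        rw [Finset.mem_powersetCard] at hS
        have hgS : g ∉ S := fun h => hgW (hS.1 h)
        rw [hitPotential, if_pos (Finset.mem_insert_self _ _), Finset.card_insert_of_notMem hgS,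
          Finset.sum_insert hgS, hS.2, ← hg]
        push_cast
        rw [Finset.erase_insert hgS, Finset.erase_eq_of_notMem hgS]
        congr 3
        refine Finset.sum_congr rfl fun d hd => ?_
        rw [Finset.erase_right_comm, Finset.erase_insert hgS]
      rw [Finset.sum_congr rfl h1, ← Finset.mul_sum, ← Finset.mul_sum, Finset.sum_add_distrib]
      refine mul_le_mul_of_nonneg_left ?_ (by linarith)
      have h2 := ih (t + 1) (G.next ω t s g) W v (by nlinarith)
      have h3 : ∑ S ∈ W.powersetCard v,
          ∑ d ∈ S, hitPotential G ω z j (t + 1) (G.next ω t s d) (S.erase d) ≤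
            v * ((1 + p * (z - 1)) ^ j * W.card.choose v) := by
        rcases v with _ | v
        · simp
        rw [sum_powersetCard_sum_erase W v
          fun d S => hitPotential G ω z j (t + 1) (G.next ω t s d) S]
        calc _ ≤ ∑ d ∈ W, (1 + p * (z - 1)) ^ j * (W.erase d).card.choose v := by
              refine Finset.sum_le_sum fun d hd => ih _ _ _ _ ?_
              rw [Finset.card_erase_of_mem hd, Nat.cast_sub (Finset.card_pos.2 ⟨d, hd⟩)]
              push_cast at hv ⊢
              linarith
          _ = _ := by
              rw [← Finset.mul_sum, sum_erase_card_choose]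
              push_cast
              ring
      calc _ ≤ ((v : ℝ) + 1)⁻¹ * ((1 + v) * ((1 + p * (z - 1)) ^ j * W.card.choose v)) := by
            refine mul_le_mul_of_nonneg_left ?_ (by positivity)
            linarith
        _ = _ := by field_simp; ring
    refine (add_le_add (key W hgW (by nlinarith)) hit).trans ?_
    have h1 : ((W.card + 1).choose (v + 1) : ℝ) = W.card.choose v + W.card.choose (v + 1) := by
      exact_mod_cast Nat.choose_succ_succ _ _
    have h2 : ((W.card : ℝ) + 1) * W.card.choose v = (W.card + 1).choose (v + 1) * (v + 1) := by
      exact_mod_cast Nat.add_one_mul_choose_eq W.card v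
    -- the fraction of the `(v+1)`-subsets of `U` that contain the guess is at most `p`
    have h3 : (W.card.choose v : ℝ) ≤ p * (W.card + 1).choose (v + 1) := by
      have hW : (0 : ℝ) < W.card + 1 := by positivity
      refine le_of_mul_le_mul_left ?_ hW
      rw [h2]
      have : (0 : ℝ) ≤ (W.card + 1).choose (v + 1) := by positivity
      have h4 : (v : ℝ) + 1 ≤ p * (W.card + 1) := by nlinarith
      nlinarith [mul_le_mul_of_nonneg_left h4 this]
    rw [pow_succ, mul_assoc]
    calc _ = (1 + p * (z - 1)) ^ j *
          ((W.card + 1).choose (v + 1) + (z - 1) * W.card.choose v) := by rw [h1]; ring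
      _ ≤ _ := by
        refine mul_le_mul_of_nonneg_left ?_ hpj
        nlinarith
end Potential

/-! ### The cards from which the Move-to-the-Back Dealer draws -/

section Choices

variable {n m : ℕ}

/-- The number of turns that precede the current epoch, when `T` turns have been played; outside of
the epochs it is `T` itself. -/
noncomputable def epochStart (n m T : ℕ) : ℕ :=
  if 2 * epochLength n m < n - T ∧ n - T ≤ firstEpoch n ∧ 0 < epochLength n m then
    T - (firstEpoch n - (n - T)) % epochLength n m
  else T

/-- The bound on the size of the back has no effect in the first `u` turns of an epoch. -/
theorem mem_back_iff (u : ℕ) (A : Finset (Fin n)) (e : Transcript n) (he : e.length ≤ u) :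
    (mtbeState u A e).2.card ≤ e.length ∧ ∀ c ∈ A, c ∉ e.map Prod.snd →
      (c ∈ (mtbeState u A e).2 ↔ c ∈ e.map Prod.fst) := by
  induction e using List.reverseRecOn with
  | nil => simp [mtbeState]
  | append_singleton e p ih =>
    rw [List.length_append, List.length_singleton] at he ⊢
    obtain ⟨ih1, ih2⟩ := ih (by omega)
    have hs : mtbeState u A (e ++ [p]) = mtbeStep u (mtbeState u A e) p := by simp [mtbeState]
    have hA := (mtbeState_spec u A e).1
    rw [hs]
    simp only [mtbeStep]
    refine ⟨?_, fun c hcA hc => ?_⟩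
    · split_ifs
      · exact (Finset.card_insert_le _ _).trans (by omega)
      · omega
    · simp only [List.map_append, List.mem_append, List.map_cons, List.map_nil,
        List.mem_singleton, not_or] at hc ⊢
      rw [← ih2 c hcA hc.1]
      split_ifs with h1
      · rw [Finset.mem_insert]; tauto
      · refine ⟨Or.inl, fun h2 => h2.resolve_right fun h3 => h1 ⟨?_, by omega⟩⟩
        rw [← h3, Finset.mem_erase, hA]
        exact ⟨hc.2, hcA, hc.1⟩

/-- The Dealer draws from the cards in the deck that have not been guessed in the current epoch.
Epochs of length 0 are left out by `epochStart`: in them the back is always empty. -/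
theorem mtbChoices_eq (h : Transcript n) (hn : h.length ≤ n) :
    mtbChoices n m h = Finset.univ.filter fun c =>
      c ∉ h.map Prod.snd ∧ c ∉ (h.drop (epochStart n m h.length)).map Prod.fst := by
  have hkn : firstEpoch n ≤ n := Nat.div_le_self _ _
  unfold mtbChoices epochStart
  simp only
  set l := epochLength n m
  set k := firstEpoch n
  split_ifs with h1 h2 h2
  · have h3 := Nat.div_add_mod (k - (n - h.length)) l
    have h4 := Nat.mod_lt (k - (n - h.length)) h2.2.2
    rw [mul_comm] at h3
    have hs : n - k + (k - (n - h.length)) / l * l =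
        h.length - (k - (n - h.length)) % l := by omega
    rw [hs]
    set s := h.length - (k - (n - h.length)) % l with hsdef
    have hlen : (h.drop s).length ≤ l := by rw [List.length_drop]; omega
    ext c
    have h5 := (mem_back_iff l (available (h.take s)) (h.drop s) hlen).2 c
    have h6 := (mtbeState_spec l (available (h.take s)) (h.drop s)).1 c
    rw [mtbeChoices, Finset.mem_sdiff, h6]
    have h7 : c ∈ h.map Prod.snd ↔ c ∈ (h.take s).map Prod.snd ∨ c ∈ (h.drop s).map Prod.snd := by
      conv_lhs => rw [← List.take_append_drop s h]
      rw [List.map_append, List.mem_append]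
    simp only [available, Finset.mem_filter, Finset.mem_univ, true_and] at h5 ⊢
    rw [h7]
    clear_value s l k
    grind
  · have hl : l = 0 := by omega
    rw [hl]
    simp only [Nat.div_zero, zero_mul, add_zero, List.drop_length, List.map_nil,
      List.not_mem_nil, not_false_eq_true, and_true]
    set s := n - k
    ext c
    have h6 := (mtbeState_spec 0 (available (h.take s)) (h.drop s)).1 c
    have h8 : (mtbeState 0 (available (h.take s)) (h.drop s)).2 = ∅ :=
      Finset.card_eq_zero.1 (Nat.le_zero.1 (mtbeState_spec 0 _ _).2)
    have h7 : c ∈ h.map Prod.snd ↔ c ∈ (h.take s).map Prod.snd ∨ c ∈ (h.drop s).map Prod.snd := by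
      conv_lhs => rw [← List.take_append_drop s h]
      rw [List.map_append, List.mem_append]
    rw [mtbeChoices, h8, Finset.sdiff_empty, h6]
    simp only [available, Finset.mem_filter, Finset.mem_univ, true_and]
    rw [h7, not_or]
  · exact absurd ⟨h2.1, h2.2.1⟩ h1
  · simp [available]

theorem mtbChoices_eq_available {h : Transcript n} (hn : h.length ≤ n)
    (hs : epochStart n m h.length = h.length) : mtbChoices n m h = available h := by
  rw [mtbChoices_eq h hn, hs]
  simp [available]

theorem card_mtbChoices_ge {T : ℕ} {h : Transcript n} (hh : Legal T h) (hn : T ≤ n) :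
    n - T ≤ (mtbChoices n m h).card + (T - epochStart n m T) := by
  rw [mtbChoices_eq h (hh.1 ▸ hn), hh.1]
  have h1 : available h ⊆ (Finset.univ.filter fun c =>
      c ∉ h.map Prod.snd ∧ c ∉ (h.drop (epochStart n m T)).map Prod.fst) ∪
        ((h.drop (epochStart n m T)).map Prod.fst).toFinset := by
    intro c hc
    simp only [available, Finset.mem_filter, Finset.mem_univ, true_and, Finset.mem_union,
      List.mem_toFinset] at hc ⊢
    tauto
  have h2 := (Finset.card_le_card h1).trans (Finset.card_union_le _ _)
  have h3 := List.toFinset_card_le ((h.drop (epochStart n m T)).map Prod.fst)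
  rw [List.length_map, List.length_drop, hh.1] at h3
  rw [hh.card_available] at h2
  omega

/-- Turn `T + i` belongs to the epoch that begins after `T` turns, unless that epoch is cut
short. -/
theorem epochStart_add {T e i : ℕ} (hT : T = n - firstEpoch n + e * epochLength n m)
    (hi : i < epochLength n m) (hend : 2 * epochLength n m + i < n - T) :
    epochStart n m (T + i) = T := by
  have hkn : firstEpoch n ≤ n := Nat.div_le_self _ _
  rw [epochStart, if_pos ⟨by omega, by omega, by omega⟩]
  have h1 : firstEpoch n - (n - (T + i)) = i + e * epochLength n m := by omega
  rw [h1, Nat.add_mul_mod_self_right, Nat.mod_eq_of_lt hi]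
  omega

/-- Within an epoch, the card drawn and the card guessed leave the set of choices. -/
theorem mtbChoices_append {T e i : ℕ} (hT : T = n - firstEpoch n + e * epochLength n m)
    (hi : i + 1 < epochLength n m) (hend : 3 * epochLength n m ≤ n - T) {h : Transcript n}
    (hh : h.length = T + i) (p : Fin n × Fin n) :
    mtbChoices n m (h ++ [p]) = ((mtbChoices n m h).erase p.2).erase p.1 := by
  have e1 : epochStart n m (h ++ [p]).length = T := by
    rw [List.length_append, List.length_singleton, hh, add_assoc]
    exact epochStart_add hT hi (by omega)
  have e2 : epochStart n m h.length = T := by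
    rw [hh]; exact epochStart_add hT (by omega) (by omega)
  rw [mtbChoices_eq _ (by rw [List.length_append, List.length_singleton]; omega), e1,
    mtbChoices_eq h (by omega), e2, List.drop_append_of_le_length (by omega)]
  ext c
  simp only [List.map_append, List.mem_append, List.map_cons, List.map_nil, List.mem_singleton,
    Finset.mem_filter, Finset.mem_univ, true_and, Finset.mem_erase]
  tauto

theorem mtbDealer_draw [NeZero n] {h : Transcript n} (hn : h.length < n) (c : Fin n) :
    ((mtbDealer n m).draw h c).toReal =
      if c ∈ mtbChoices n m h then ((mtbChoices n m h).card : ℝ)⁻¹ else 0 := by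
  have hS := (mtbChoices_spec (m := m) h hn).2
  simp only [mtbDealer, dif_pos hS, PMF.uniformOfFinset_apply]
  split_ifs <;> simp

end Choices

/-! ### The number of hits in an epoch -/

section Hits

variable {Ω : Type*} [MeasurableSpace Ω] {n m : ℕ} [NeZero n] (G : Guesser Ω n m) (ω : Ω)

theorem turn_mtbDealer {t : ℕ} (ht : t < n) (F : (Fin m → Bool) × Transcript n → ℝ)
    {x : (Fin m → Bool) × Transcript n} (hx : Legal t x.2) :
    turn (mtbDealer n m) G ω t F x =
      ((mtbChoices n m x.2).card : ℝ)⁻¹ * ∑ c ∈ mtbChoices n m x.2, F (after G ω t x c) := by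
  simp only [turn, mtbDealer_draw (m := m) (hx.1 ▸ ht : x.2.length < n), ite_mul, zero_mul,
    Finset.mul_sum, Finset.sum_ite_mem, Finset.univ_inter]

/-- The density of the uniform shuffle with respect to the Move-to-the-Back Dealer, on the draws of
the transcript `h`. -/
noncomputable def shuffleWeight (m : ℕ) (h : Transcript n) : ℝ :=
  ∏ i ∈ Finset.range h.length,
    ((mtbChoices n m (h.take i)).card : ℝ) / (available (h.take i)).card

omit [NeZero n] in
theorem shuffleWeight_append (h : Transcript n) (p : Fin n × Fin n) :
    shuffleWeight m (h ++ [p]) =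
      shuffleWeight m h * ((mtbChoices n m h).card / (available h).card) := by
  rw [shuffleWeight, List.length_append, List.length_singleton, Finset.prod_range_succ,
    shuffleWeight]
  congr 1
  · refine Finset.prod_congr rfl fun i hi => ?_
    rw [List.take_append_of_le_length (Finset.mem_range.1 hi).le]
  · simp

/-- With the weight, the cards left in the deck are distributed at most as in a uniform shuffle. -/
theorem expect_shuffleWeight_mul_le {T : ℕ} (hT : T ≤ n) (f : Finset (Fin n) → ℝ)
    (hf : ∀ A, 0 ≤ f A) :
    expect (mtbDealer n m) G ω T (fun x => shuffleWeight m x.2 * f (available x.2)) ≤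
      (n.choose (n - T) : ℝ)⁻¹ * ∑ A ∈ (Finset.univ : Finset (Fin n)).powersetCard (n - T), f A := by
  induction T generalizing f with
  | zero =>
    have h1 : (Finset.univ : Finset (Fin n)).powersetCard n = {Finset.univ} := by
      have := Finset.powersetCard_self (Finset.univ : Finset (Fin n))
      rwa [Finset.card_univ, Fintype.card_fin] at this
    simp [expect, shuffleWeight, available, h1]
  | succ T ih =>
    obtain ⟨v, hv⟩ : ∃ v, n - T = v + 1 := ⟨n - T - 1, by omega⟩
    have hv' : n - (T + 1) = v := by omega
    have h1 := ih (by omega) (fun A => (A.card : ℝ)⁻¹ * ∑ c ∈ A, f (A.erase c)) fun A => by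
      have := Finset.sum_nonneg fun c (_ : c ∈ A) => hf (A.erase c)
      positivity
    rw [hv']
    rw [expect]
    refine le_trans (expect_mono _ _ _ (by omega) fun x hx => ?_) (h1.trans (le_of_eq ?_))
    · have hs := mtbChoices_spec (m := m) x.2 (by rw [hx.1]; omega)
      have hc : (0 : ℝ) < (mtbChoices n m x.2).card := by exact_mod_cast hs.2.card_pos
      have hw : 0 ≤ shuffleWeight m x.2 := Finset.prod_nonneg fun i _ => by positivity
      rw [turn_mtbDealer G ω (by omega) _ hx]
      simp only [after, shuffleWeight_append, available_append]
      rw [← Finset.mul_sum]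
      calc _ = shuffleWeight m x.2 * (((available x.2).card : ℝ)⁻¹ *
            ∑ c ∈ mtbChoices n m x.2, f ((available x.2).erase c)) := by field_simp
        _ ≤ _ := by
          gcongr
          · exact fun i _ _ => hf _
          · exact hs.1
    · rw [hv, Finset.sum_congr rfl fun A hA => by rw [(Finset.mem_powersetCard.1 hA).2],
        ← Finset.mul_sum, sum_powersetCard_sum_erase _ _ fun _ S => f S]
      have h2 : ∑ d : Fin n, ∑ S ∈ (Finset.univ.erase d).powersetCard v, f S =
          (n - v) * ∑ S ∈ (Finset.univ : Finset (Fin n)).powersetCard v, f S := by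
        rw [Finset.sum_comm' (t' := (Finset.univ : Finset (Fin n)).powersetCard v)
          (s' := fun S => Sᶜ), Finset.mul_sum]
        · refine Finset.sum_congr rfl fun S hS => ?_
          rw [Finset.sum_const, nsmul_eq_mul, Finset.card_compl, Fintype.card_fin,
            (Finset.mem_powersetCard.1 hS).2, Nat.cast_sub (by omega)]
        · intro d S
          simp only [Finset.mem_univ, true_and, Finset.mem_powersetCard, Finset.subset_univ,
            Finset.mem_compl, Finset.subset_erase]
      rw [h2]
      have h3 : (n.choose (v + 1) : ℝ) * (v + 1) = n.choose v * (n - v) := by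
        have := Nat.choose_succ_right_eq n v
        rw [← Nat.cast_sub (by omega)]
        exact_mod_cast this
      have h4 : (0 : ℝ) < n.choose (v + 1) := by exact_mod_cast Nat.choose_pos (by omega)
      have h5 : (0 : ℝ) < n.choose v := by exact_mod_cast Nat.choose_pos (by omega)
      push_cast
      rw [← mul_assoc, ← mul_assoc]
      congr 1
      field_simp
      linarith

/-- The probability that the guess in turn `t` is a hit: a card that the Dealer may draw. -/
noncomputable def hitProb (t : ℕ) : ℝ :=
  expect (mtbDealer n m) G ω t fun x => if G.guess ω t x.1 ∈ mtbChoices n m x.2 then 1 else 0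

/-- The conditional expectation of the number of hits in the next `j` turns, given the state before
turn `t`. -/
noncomputable def expectedHits : ℕ → ℕ → (Fin m → Bool) × Transcript n → ℝ
  | 0, _, _ => 0
  | j + 1, t, x => (if G.guess ω t x.1 ∈ mtbChoices n m x.2 then 1 else 0) +
      turn (mtbDealer n m) G ω t (expectedHits j (t + 1)) x

theorem expect_expectedHits (j t : ℕ) :
    expect (mtbDealer n m) G ω t (expectedHits G ω j t) =
      ∑ i ∈ Finset.range j, hitProb G ω (t + i) := by
  induction j generalizing t with
  | zero => simpa [expectedHits] using expect_const _ G ω t 0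
  | succ j ih =>
    have h1 : expect (mtbDealer n m) G ω t (expectedHits G ω (j + 1) t) =
        hitProb G ω t + expect (mtbDealer n m) G ω (t + 1) (expectedHits G ω j (t + 1)) := by
      rw [hitProb, expect, ← expect_add]; rfl
    rw [h1, ih, Finset.sum_range_succ', add_comm]
    simp only [add_zero, add_assoc, add_comm 1]

/-- Jensen's inequality for the number of hits in an epoch, in the form `1 + y ≤ exp y`. -/
theorem le_exp_mul_hitPotential {T e : ℕ} (hT : T = n - firstEpoch n + e * epochLength n m)
    (hend : 3 * epochLength n m ≤ n - T) {z : ℝ} (hz : 1 ≤ z) (j i : ℕ)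
    (hij : i + j ≤ epochLength n m) (y : ℝ) {x : (Fin m → Bool) × Transcript n}
    (hx : Legal (T + i) x.2) :
    1 + y + Real.log z * expectedHits G ω j (T + i) x ≤
      Real.exp y * hitPotential G ω z j (T + i) x.1 (mtbChoices n m x.2) := by
  induction j generalizing i x y with
  | zero =>
    simp only [expectedHits, hitPotential, mul_zero, add_zero, mul_one]
    linarith [Real.add_one_le_exp y]
  | succ j ih =>
    have hlt : T + i < n := by omega
    have hs := mtbChoices_spec (m := m) x.2 (by rw [hx.1]; omega)
    have hc : (0 : ℝ) < (mtbChoices n m x.2).card := by exact_mod_cast hs.2.card_pos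
    rw [expectedHits, hitPotential, turn_mtbDealer G ω hlt _ hx]
    set S := mtbChoices n m x.2 with hS
    set g := G.guess ω (T + i) x.1 with hg
    set y' := y + if g ∈ S then Real.log z else 0 with hy'
    have hexp : Real.exp y * (if g ∈ S then z else 1) = Real.exp y' := by
      rw [hy']
      split_ifs
      · rw [Real.exp_add, Real.exp_log (by linarith)]
      · simp
    have hd : ∀ d ∈ S, 1 + y' +
          Real.log z * expectedHits G ω j (T + i + 1) (after G ω (T + i) x d) ≤
        Real.exp y' * hitPotential G ω z j (T + i + 1) (G.next ω (T + i) x.1 d)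
          ((S.erase d).erase g) := by
      intro d hdS
      rcases j with _ | j
      · simp only [expectedHits, hitPotential, mul_zero, add_zero, mul_one]
        linarith [Real.add_one_le_exp y']
      · have h1 := ih (i + 1) (by omega) y' (hx.append g (hs.1 hdS))
          (x := after G ω (T + i) x d)
        have h2 := mtbChoices_append (m := m) hT (i := i) (by omega) hend hx.1 (g, d)
        have h3 : (after G ω (T + i) x d).2 = x.2 ++ [(g, d)] := rfl
        rw [h3, h2] at h1
        exact h1
    rw [← mul_assoc, hexp]
    calc _ = (S.card : ℝ)⁻¹ * ∑ d ∈ S, (1 + y' +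
          Real.log z * expectedHits G ω j (T + i + 1) (after G ω (T + i) x d)) := by
          rw [Finset.sum_add_distrib, Finset.sum_const, nsmul_eq_mul, ← Finset.mul_sum, hy']
          field_simp
          split_ifs <;> ring
      _ ≤ (S.card : ℝ)⁻¹ * ∑ d ∈ S, Real.exp y' * hitPotential G ω z j (T + i + 1)
          (G.next ω (T + i) x.1 d) ((S.erase d).erase g) :=
          mul_le_mul_of_nonneg_left (Finset.sum_le_sum hd) (by positivity)
      _ = _ := by rw [← Finset.mul_sum]; ring

/-- The entropy bound.  Under the uniform shuffle, a Guesser who starts an epoch in a fixed memory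
state makes few hits.  To make more, she has to pay with her memory, which costs `m * log 2`, or
with the influence that her earlier guesses had on the cards left in the deck. -/
theorem log_mul_sum_hitProb_le {T e : ℕ} (hT : T = n - firstEpoch n + e * epochLength n m)
    (hl : 0 < epochLength n m) (hend : 3 * epochLength n m ≤ n - T)
    {z p : ℝ} (hz : 1 ≤ z) (hp : 0 ≤ p)
    (hv : ((n - T : ℕ) : ℝ) ≤ p * (n - 2 * epochLength n m)) :
    Real.log z * ∑ i ∈ Finset.range (epochLength n m), hitProb G ω (T + i) ≤
      m * Real.log 2 + p * (z - 1) * epochLength n m +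
        expect (mtbDealer n m) G ω T (fun x => -Real.log (shuffleWeight m x.2)) := by
  have hTn : T ≤ n := by omega
  set l := epochLength n m
  set c : ℝ := m * Real.log 2 + p * (z - 1) * l with hcdef
  have hq : 0 ≤ p * (z - 1) := mul_nonneg hp (by linarith)
  have hw : ∀ x : (Fin m → Bool) × Transcript n, Legal T x.2 → 0 < shuffleWeight m x.2 := by
    intro x hx
    refine Finset.prod_pos fun i hi => ?_
    have hs := mtbChoices_spec (m := m) (x.2.take i) (by
      rw [List.length_take]; have := Finset.mem_range.1 hi; have := hx.1; omega)
    have h1 := hs.2.card_pos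
    have h2 := (hs.2.mono hs.1).card_pos
    positivity
  -- the potential, summed over the memory states at the beginning of the epoch
  have h1 : expect (mtbDealer n m) G ω T (fun x => shuffleWeight m x.2 *
      hitPotential G ω z l T x.1 (mtbChoices n m x.2)) ≤ Real.exp c := by
    calc _ ≤ expect (mtbDealer n m) G ω T (fun x => shuffleWeight m x.2 *
          ∑ s, hitPotential G ω z l T s (available x.2)) := by
          refine expect_mono _ _ _ hTn fun x hx => mul_le_mul_of_nonneg_left ?_ (hw x hx).le
          have h2 := epochStart_add (m := m) hT (i := 0) hl (by omega)
          rw [mtbChoices_eq_available (by rw [hx.1]; exact hTn) (by rw [hx.1]; exact h2)]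
          exact Finset.single_le_sum (f := fun s => hitPotential G ω z l T s (available x.2))
            (fun s _ => hitPotential_nonneg G ω (by linarith) _ _ _ _) (Finset.mem_univ x.1)
      _ ≤ _ := expect_shuffleWeight_mul_le G ω hTn
          (fun A => ∑ s, hitPotential G ω z l T s A) fun A => Finset.sum_nonneg fun s _ =>
            hitPotential_nonneg G ω (by linarith) _ _ _ _
      _ ≤ (n.choose (n - T) : ℝ)⁻¹ * ∑ s : Fin m → Bool,
            (1 + p * (z - 1)) ^ l * n.choose (n - T) := by
          rw [Finset.sum_comm]
          refine mul_le_mul_of_nonneg_left (Finset.sum_le_sum fun s _ => ?_) (by positivity)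
          have h3 := sum_hitPotential_le G ω hz hp l T s Finset.univ (n - T)
            (by rw [Finset.card_univ, Fintype.card_fin]; exact hv)
          rwa [Finset.card_univ, Fintype.card_fin] at h3
      _ = 2 ^ m * (1 + p * (z - 1)) ^ l := by
          have h4 : (0 : ℝ) < n.choose (n - T) := by exact_mod_cast Nat.choose_pos (by omega)
          rw [Finset.sum_const, nsmul_eq_mul, Finset.card_univ, Fintype.card_fun,
            Fintype.card_bool, Fintype.card_fin]
          push_cast
          field_simp
      _ ≤ Real.exp (m * Real.log 2) * Real.exp (p * (z - 1)) ^ l := by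
          rw [mul_comm (m : ℝ), Real.exp_mul, Real.exp_log two_pos, Real.rpow_natCast]
          gcongr
          linarith [Real.add_one_le_exp (p * (z - 1))]
      _ = _ := by rw [← Real.exp_nat_mul, ← Real.exp_add, hcdef]; congr 1; ring
  have h2 : expect (mtbDealer n m) G ω T (fun x => 1 + (Real.log (shuffleWeight m x.2) + -c) +
      Real.log z * expectedHits G ω l T x) ≤ expect (mtbDealer n m) G ω T (fun x =>
        Real.exp (-c) * (shuffleWeight m x.2 *
          hitPotential G ω z l T x.1 (mtbChoices n m x.2))) := by
    refine expect_mono _ _ _ hTn fun x hx => ?_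
    have h3 := le_exp_mul_hitPotential G ω hT hend hz l 0 (by omega)
      (Real.log (shuffleWeight m x.2) + -c) (x := x) hx
    rw [Real.exp_add, Real.exp_log (hw x hx)] at h3
    refine h3.trans (le_of_eq ?_)
    rw [add_zero]; ring
  rw [expect_add, expect_add, expect_add, expect_const, expect_const, expect_const_mul,
    expect_const_mul, expect_expectedHits] at h2
  have h3 : Real.exp (-c) * expect (mtbDealer n m) G ω T (fun x => shuffleWeight m x.2 *
      hitPotential G ω z l T x.1 (mtbChoices n m x.2)) ≤ 1 := by
    refine (mul_le_mul_of_nonneg_left h1 (Real.exp_pos _).le).trans (le_of_eq ?_)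
    rw [← Real.exp_add]; simp
  have h4 : expect (mtbDealer n m) G ω T (fun x => -Real.log (shuffleWeight m x.2)) =
      - expect (mtbDealer n m) G ω T (fun x => Real.log (shuffleWeight m x.2)) := by
    rw [← neg_one_mul, ← expect_const_mul]; simp only [neg_one_mul]
  rw [h4]
  linarith

/-! ### The influence of the Guesser on the cards left in the deck -/

theorem hitProb_nonneg {t : ℕ} (ht : t ≤ n) : 0 ≤ hitProb G ω t := by
  exact (expect_const (mtbDealer n m) G ω t 0).symm.le.trans
    (expect_mono _ _ _ ht fun x _ => by split_ifs <;> norm_num)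

/-- The expected relative entropy of the draw in turn `t` with respect to a uniform draw from the
deck. -/
noncomputable def drawCost (t : ℕ) : ℝ :=
  expect (mtbDealer n m) G ω t fun x =>
    Real.log ((available x.2).card / (mtbChoices n m x.2).card)

/-- The chain rule for the relative entropy. -/
theorem expect_neg_log_shuffleWeight {T : ℕ} (hT : T ≤ n) :
    expect (mtbDealer n m) G ω T (fun x => -Real.log (shuffleWeight m x.2)) =
      ∑ i ∈ Finset.range T, drawCost G ω i := by
  induction T with
  | zero => simp [expect, shuffleWeight]
  | succ T ih =>
    rw [Finset.sum_range_succ, ← ih (by omega), drawCost, ← expect_add, expect]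
    refine expect_congr _ _ _ (by omega) fun x hx => ?_
    have hpos : ∀ i ≤ T, 0 < (mtbChoices n m (x.2.take i)).card ∧
        0 < (available (x.2.take i)).card := fun i hi => by
      have hs := mtbChoices_spec (m := m) (x.2.take i) (by rw [List.length_take]; omega)
      exact ⟨hs.2.card_pos, (hs.2.mono hs.1).card_pos⟩
    have h1 : shuffleWeight m x.2 ≠ 0 := by
      refine (Finset.prod_pos fun i hi => ?_).ne'
      have := hpos i (by have := Finset.mem_range.1 hi; have := hx.1; omega)
      exact div_pos (by exact_mod_cast this.1) (by exact_mod_cast this.2)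
    obtain ⟨h2, h3⟩ := hpos T le_rfl
    rw [← hx.1, List.take_length] at h2 h3
    have h2' : ((mtbChoices n m x.2).card : ℝ) ≠ 0 := by exact_mod_cast h2.ne'
    have h3' : ((available x.2).card : ℝ) ≠ 0 := by exact_mod_cast h3.ne'
    simp only [turn, after, shuffleWeight_append]
    rw [← Finset.sum_mul, sum_draw, one_mul, Real.log_mul h1 (div_ne_zero h2' h3'),
      Real.log_div h2' h3', Real.log_div h3' h2']
    ring

theorem drawCost_eq_zero {t : ℕ} (ht : t ≤ n) (hs : epochStart n m t = t) :
    drawCost G ω t = 0 := by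
  rw [drawCost, ← expect_const (mtbDealer n m) G ω t 0]
  refine expect_congr _ _ _ ht fun x hx => ?_
  rw [mtbChoices_eq_available (by rw [hx.1]; exact ht) (by rw [hx.1]; exact hs)]
  by_cases h : ((available x.2).card : ℝ) = 0
  · simp [h]
  · rw [div_self h, Real.log_one]

/-- The number of cards at the back is at most the number of hits in the current epoch. -/
theorem expect_card_back_le {T e : ℕ} (hT : T = n - firstEpoch n + e * epochLength n m)
    (hend : 3 * epochLength n m ≤ n - T) (i : ℕ) (hi : i < epochLength n m) :
    expect (mtbDealer n m) G ω (T + i) (fun x =>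
      ((available x.2).card : ℝ) - (mtbChoices n m x.2).card) ≤
        ∑ j ∈ Finset.range i, hitProb G ω (T + j) := by
  induction i with
  | zero =>
    rw [Finset.range_zero, Finset.sum_empty, ← expect_const (mtbDealer n m) G ω (T + 0) 0]
    refine expect_mono _ _ _ (by omega) fun x hx => ?_
    have h2 := epochStart_add (m := m) hT hi (by omega)
    rw [mtbChoices_eq_available (by rw [hx.1]; omega) (by rw [hx.1]; exact h2), sub_self]
  | succ i ih =>
    rw [Finset.sum_range_succ]
    refine le_trans ?_ (add_le_add_left (ih (by omega)) _)
    rw [hitProb, ← expect_add, ← add_assoc, expect]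
    refine expect_mono _ _ _ (by omega) fun x hx => ?_
    have hs := mtbChoices_spec (m := m) x.2 (by rw [hx.1]; omega)
    have hc : (0 : ℝ) < (mtbChoices n m x.2).card := by exact_mod_cast hs.2.card_pos
    rw [turn_mtbDealer G ω (by omega) _ hx, inv_mul_le_iff₀ hc, ← nsmul_eq_mul,
      ← Finset.sum_const]
    refine Finset.sum_le_sum fun c hcS => ?_
    simp only [after, available_append, mtbChoices_append hT hi hend hx.1]
    rw [Finset.card_erase_of_mem (hs.1 hcS), Nat.cast_sub (Finset.card_pos.2 ⟨c, hs.1 hcS⟩)]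
    set g := G.guess ω (T + i) x.1
    have h1 := Finset.card_erase_add_one hcS
    have h2 : ((mtbChoices n m x.2).erase c).card ≤
        (((mtbChoices n m x.2).erase c).erase g).card + if g ∈ mtbChoices n m x.2 then 1 else 0 := by
      split_ifs with hg
      · have := Finset.pred_card_le_card_erase (s := (mtbChoices n m x.2).erase c) (a := g)
        omega
      · rw [Finset.erase_eq_of_notMem fun h => hg (Finset.mem_of_mem_erase h)]
        omega
    rw [← h1]
    have h3 : (((mtbChoices n m x.2).erase c).card : ℝ) ≤
        (((mtbChoices n m x.2).erase c).erase g).card +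
          if g ∈ mtbChoices n m x.2 then 1 else 0 := by exact_mod_cast h2
    push_cast
    linarith

omit [NeZero n] in
/-- At any turn of an epoch, fewer than `ℓ` of the cards that were in the deck at its beginning have
been drawn, and fewer than `ℓ` are at the back. -/
theorem card_mtbChoices_ge_of_epoch {T e i : ℕ}
    (hT : T = n - firstEpoch n + e * epochLength n m) (hend : 3 * epochLength n m ≤ n - T)
    (hi : i < epochLength n m) {h : Transcript n} (hh : Legal (T + i) h) :
    ((n - T : ℕ) : ℝ) - 2 * epochLength n m ≤ (mtbChoices n m h).card := by
  have h1 := card_mtbChoices_ge (m := m) hh (by omega)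
  rw [epochStart_add hT hi (by omega)] at h1
  have h2 : n - T ≤ (mtbChoices n m h).card + 2 * epochLength n m := by omega
  have h3 : ((n - T : ℕ) : ℝ) ≤ (mtbChoices n m h).card + 2 * epochLength n m := by
    exact_mod_cast h2
  linarith

/-- The relative entropy that an epoch contributes is small if it has few hits. -/
theorem sum_drawCost_le {T e : ℕ} (hT : T = n - firstEpoch n + e * epochLength n m)
    (hl : 0 < epochLength n m) (hend : 3 * epochLength n m ≤ n - T) :
    ∑ i ∈ Finset.range (epochLength n m), drawCost G ω (T + i) ≤
      epochLength n m / (((n - T : ℕ) : ℝ) - 2 * epochLength n m) *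
        ∑ i ∈ Finset.range (epochLength n m), hitProb G ω (T + i) := by
  set l := epochLength n m
  have hl' : (0 : ℝ) < l := by exact_mod_cast hl
  have hpos : 0 < ((n - T : ℕ) : ℝ) - 2 * l := by
    have : ((3 * l : ℕ) : ℝ) ≤ (n - T : ℕ) := by exact_mod_cast hend
    push_cast at this
    linarith
  set a := ((n - T : ℕ) : ℝ) - 2 * l
  calc _ ≤ ∑ i ∈ Finset.range l, a⁻¹ * ∑ j ∈ Finset.range l, hitProb G ω (T + j) := by
        refine Finset.sum_le_sum fun i hi => ?_
        rw [Finset.mem_range] at hi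
        calc drawCost G ω (T + i) ≤ expect (mtbDealer n m) G ω (T + i) (fun x => a⁻¹ *
              (((available x.2).card : ℝ) - (mtbChoices n m x.2).card)) := by
              refine expect_mono _ _ _ (by omega) fun x hx => ?_
              have h1 : a ≤ _ := card_mtbChoices_ge_of_epoch hT hend hi hx
              have hs := mtbChoices_spec (m := m) x.2 (by rw [hx.1]; omega)
              have h2 : (0 : ℝ) < (mtbChoices n m x.2).card := hpos.trans_le h1
              have h3 : ((mtbChoices n m x.2).card : ℝ) ≤ (available x.2).card := by
                exact_mod_cast Finset.card_le_card hs.1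
              refine (Real.log_le_sub_one_of_pos (div_pos (h2.trans_le h3) h2)).trans ?_
              rw [div_sub_one h2.ne', div_eq_inv_mul]
              exact mul_le_mul_of_nonneg_right (inv_anti₀ hpos h1) (by linarith)
          _ ≤ _ := by
              rw [expect_const_mul]
              refine mul_le_mul_of_nonneg_left ((expect_card_back_le G ω hT hend i hi).trans ?_)
                (by positivity)
              refine Finset.sum_le_sum_of_subset_of_nonneg
                (Finset.range_subset_range.2 hi.le) fun j hj _ => hitProb_nonneg G ω ?_
              have := Finset.mem_range.1 hj
              omega
    _ = _ := by
        rw [Finset.sum_const, Finset.card_range, nsmul_eq_mul]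
        ring

/-! ### Few hits in every epoch -/

theorem ceil_eight_mul_exp_one : ⌈8 * Real.exp 1⌉₊ = 22 := by
  rw [Nat.ceil_eq_iff (by norm_num)]
  have h1 := Real.exp_one_gt_d9
  have h2 := Real.exp_one_lt_d9
  norm_num
  constructor <;> linarith

/-- The harmonic sum over the epochs, by comparison with the logarithm. -/
theorem sum_epoch_le_log {k l : ℝ} (hl : 0 < l) (e : ℕ) (he : 0 < k - e * l - 2 * l) :
    ∑ i ∈ Finset.range e, l / (k - i * l - 2 * l) ≤
      Real.log ((k - 2 * l) / (k - e * l - 2 * l)) := by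
  induction e with
  | zero =>
    simp only [Nat.cast_zero, zero_mul, sub_zero] at he ⊢
    simp [div_self he.ne']
  | succ e ih =>
    push_cast at he ⊢
    have ha : 0 < k - e * l - 2 * l := by linarith
    have hk : 0 < k - 2 * l := by nlinarith [e.cast_nonneg (α := ℝ)]
    rw [Finset.sum_range_succ]
    refine (add_le_add_left (ih ha) _).trans ?_
    rw [Real.log_div hk.ne' ha.ne', Real.log_div hk.ne' he.ne']
    have h1 := Real.log_le_sub_one_of_pos (div_pos he ha)
    rw [Real.log_div he.ne' ha.ne'] at h1
    have h2 : (k - (e + 1) * l - 2 * l) / (k - e * l - 2 * l) - 1 =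
        -(l / (k - e * l - 2 * l)) := by
      rw [div_sub_one ha.ne', ← neg_div]; congr 1; ring
    linarith

/-- The inequality between the cost and the gain of `X` hits in an epoch that begins with `t`
cards, with the exponent `log (n / (L * t))`, which makes the second term of the cost at most
`2 * m`. -/
theorem le_two_mul_of_entropy_bound {n m L k l t X S : ℝ} (hlL : l = m * L) (hL' : 1 ≤ L)
    (hm' : 1 ≤ m) (hkL' : 22 * L * k ≤ n) (ht4 : 4 * l ≤ t) (htk : t ≤ k) (hX0 : 0 ≤ X)
    (hlog : S ≤ Real.log (2 * k / t))
    (hbound : Real.log (n / (L * t)) * X ≤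
      m * Real.log 2 + t / (n - 2 * l) * (n / (L * t) - 1) * l + 2 * m * S) : X ≤ 2 * m := by
  have hl : 0 < l := hlL ▸ by positivity
  have ht0 : 0 < t := by linarith
  have hk0 : 0 < k := by linarith
  have hn22 : 22 * k ≤ n := by nlinarith
  have hz : Real.log 11 + Real.log (2 * k / t) ≤ Real.log (n / (L * t)) := by
    rw [← Real.log_mul (by norm_num) (by positivity)]
    refine Real.log_le_log (by positivity) ?_
    rw [← mul_div_assoc, div_le_div_iff₀ ht0 (by positivity)]
    nlinarith
  have hpz : t / (n - 2 * l) * (n / (L * t) - 1) * l ≤ 2 * m := by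
    have hd : 0 < n - 2 * l := by linarith
    have h1 : t / (n - 2 * l) * (n / (L * t) - 1) * l ≤ t / (n - 2 * l) * (n / (L * t)) * l := by
      gcongr
      linarith
    refine h1.trans ?_
    have h2 : t / (n - 2 * l) * (n / (L * t)) * l = m * n / (n - 2 * l) := by
      rw [hlL] at hd ⊢
      field_simp
    rw [h2, div_le_iff₀ hd]
    nlinarith
  have h11 : 2 ≤ Real.log 11 := by
    rw [Real.le_log_iff_exp_le (by norm_num), show (2 : ℝ) = 1 + 1 by norm_num, Real.exp_add]
    nlinarith [Real.exp_one_lt_d9, Real.exp_one_gt_d9]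
  have hM : 0 ≤ Real.log (2 * k / t) := Real.log_nonneg (by rw [one_le_div ht0]; linarith)
  set M := Real.log (2 * k / t)
  have h2 : Real.log 2 ≤ 1 := by linarith [Real.log_two_lt_d9]
  have h3 : (2 + M) * X ≤ (2 + M) * (2 * m) := by
    have e1 : (2 + M) * X ≤ Real.log (n / (L * t)) * X :=
      mul_le_mul_of_nonneg_right (by linarith) hX0
    have e2 : m * Real.log 2 ≤ m := by nlinarith
    have e3 := mul_le_mul_of_nonneg_left hlog (by positivity : (0 : ℝ) ≤ 2 * m)
    nlinarith
  exact le_of_mul_le_mul_left h3 (by linarith)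

/-- In every epoch that begins with at least `4 ℓ` cards, the expected number of hits is at most
`2 * m`. -/
theorem sum_hitProb_le (hn : 2 ≤ n) (hm : 1 ≤ m) (e : ℕ)
    (he : (e + 4) * epochLength n m ≤ firstEpoch n) :
    ∑ i ∈ Finset.range (epochLength n m),
      hitProb G ω (n - firstEpoch n + e * epochLength n m + i) ≤ 2 * m := by
  have hL : 0 < Nat.clog 2 n := Nat.clog_pos one_lt_two (by omega)
  have hkn : firstEpoch n ≤ n := Nat.div_le_self _ _
  have hkL : 22 * Nat.clog 2 n * firstEpoch n ≤ n := by
    rw [firstEpoch, ceil_eight_mul_exp_one]; exact Nat.mul_div_le _ _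
  have hl0 : 0 < epochLength n m := Nat.mul_pos hm hL
  have hlL : (epochLength n m : ℝ) = m * Nat.clog 2 n := by rw [epochLength]; push_cast; rfl
  set k := firstEpoch n
  set l := epochLength n m
  set L := Nat.clog 2 n
  have hl : (0 : ℝ) < l := by exact_mod_cast hl0
  have hL' : (1 : ℝ) ≤ L := by exact_mod_cast hL
  have hm' : (1 : ℝ) ≤ m := by exact_mod_cast hm
  have hkL' : 22 * (L : ℝ) * k ≤ n := by exact_mod_cast hkL
  induction e using Nat.strong_induction_on with
  | _ e ih =>
  set X := ∑ i ∈ Finset.range l, hitProb G ω (n - k + e * l + i) with hX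
  have hel : e * l + 4 * l ≤ k := by rw [← add_mul]; exact he
  have hX0 : 0 ≤ X := Finset.sum_nonneg fun i hi => hitProb_nonneg G ω (by
    have := Finset.mem_range.1 hi; omega)
  have hnT : ∀ i, i ≤ e → ((n - (n - k + i * l) : ℕ) : ℝ) = k - i * l := by
    intro i hi
    have := Nat.mul_le_mul_right l hi
    rw [show n - (n - k + i * l) = k - i * l by omega, Nat.cast_sub (by omega)]
    push_cast; rfl
  have hend : ∀ i, i ≤ e → 3 * l ≤ n - (n - k + i * l) := by
    intro i hi
    have := Nat.mul_le_mul_right l hi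
    omega
  -- the cost of the earlier epochs
  have hcost : expect (mtbDealer n m) G ω (n - k + e * l)
      (fun x => -Real.log (shuffleWeight m x.2)) ≤
        2 * m * ∑ i ∈ Finset.range e, l / ((k : ℝ) - i * l - 2 * l) := by
    rw [expect_neg_log_shuffleWeight G ω (by omega), Finset.mul_sum]
    have : ∀ a, a ≤ e → ∑ i ∈ Finset.range (n - k + a * l), drawCost G ω i ≤
        ∑ i ∈ Finset.range a, 2 * m * (l / ((k : ℝ) - i * l - 2 * l)) := by
      intro a ha
      induction a with
      | zero =>
        rw [Finset.range_zero, Finset.sum_empty]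
        refine (Finset.sum_eq_zero fun i hi => drawCost_eq_zero G ω ?_ ?_).le
        · have := Finset.mem_range.1 hi; omega
        · rw [epochStart, if_neg]
          have := Finset.mem_range.1 hi
          omega
      | succ a iha =>
        have hale := Nat.mul_le_mul_right l (by omega : a + 1 ≤ e)
        rw [add_mul, one_mul, ← add_assoc, Finset.sum_range_add, Finset.sum_range_succ]
        refine add_le_add (iha (by omega)) ?_
        refine (sum_drawCost_le G ω rfl hl0 (hend a (by omega))).trans ?_
        rw [hnT a (by omega), mul_comm]
        refine mul_le_mul_of_nonneg_right
          (ih a (by omega) ((Nat.mul_le_mul_right l (by omega)).trans he)) ?_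
        have h1 : (a : ℝ) * l + 4 * l ≤ k := by
          exact_mod_cast (by rw [add_mul] at hale; omega : a * l + 4 * l ≤ k)
        exact div_nonneg hl.le (by linarith)
    exact this e le_rfl
  have hel' : (e : ℝ) * l + 4 * l ≤ k := by exact_mod_cast hel
  set t : ℝ := k - e * l with ht
  have ht4 : 4 * l ≤ t := by linarith
  have ht0 : 0 < t := by linarith
  have htk : t ≤ k := by have : 0 ≤ (e : ℝ) * l := by positivity
                         linarith
  have hk0 : (0 : ℝ) < k := by linarith
  have hlog : ∑ i ∈ Finset.range e, l / ((k : ℝ) - i * l - 2 * l) ≤ Real.log (2 * k / t) := by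
    refine (sum_epoch_le_log hl e (by linarith)).trans
      (Real.log_le_log (div_pos (by linarith) (by linarith)) ?_)
    rw [← ht, div_le_div_iff₀ (by linarith) ht0]
    nlinarith
  have hn22 : 22 * (k : ℝ) ≤ n := by nlinarith
  have hbound := log_mul_sum_hitProb_le G ω (T := n - k + e * l) rfl hl0 (hend e le_rfl)
    (z := n / (L * t)) (p := t / (n - 2 * l))
    (by rw [one_le_div (by positivity)]; nlinarith)
    (div_nonneg ht0.le (by linarith))
    (by rw [hnT e le_rfl, div_mul_cancel₀ _ (by linarith)])
  rw [← hX] at hbound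
  exact le_two_mul_of_entropy_bound hlL hL' hm' hkL' ht4 htk hX0 hlog
    (hbound.trans (add_le_add_right hcost _))

/-! ### The sum over all turns -/

/-- The probability that the guess in turn `t` is correct. -/
noncomputable def correctProb (t : ℕ) : ℝ :=
  expect (mtbDealer n m) G ω t fun x => ((mtbDealer n m).draw x.2 (G.guess ω t x.1)).toReal

/-- A guess is correct only if it is a hit, and then with probability `1 / |S|`. -/
theorem correctProb_le {t : ℕ} (ht : t < n) {a : ℝ} (ha : 0 < a)
    (hS : ∀ h : Transcript n, Legal t h → a ≤ (mtbChoices n m h).card) :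
    correctProb G ω t ≤ a⁻¹ * hitProb G ω t := by
  rw [correctProb, hitProb, ← expect_const_mul]
  refine expect_mono _ _ _ ht.le fun x hx => ?_
  rw [mtbDealer_draw (by rw [hx.1]; exact ht)]
  split_ifs
  · rw [mul_one]; exact inv_anti₀ ha (hS _ hx)
  · simp

theorem correctProb_le_inv {t : ℕ} (ht : t < n) {a : ℝ} (ha : 0 < a)
    (hS : ∀ h : Transcript n, Legal t h → a ≤ (mtbChoices n m h).card) :
    correctProb G ω t ≤ a⁻¹ := by
  refine (correctProb_le G ω ht ha hS).trans (mul_le_of_le_one_right (by positivity) ?_)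
  exact (expect_mono _ _ _ ht.le fun x _ => by split_ifs <;> norm_num).trans
    (expect_const (mtbDealer n m) G ω t 1).le

/-- Outside of the epochs the Dealer draws from the whole deck. -/
theorem correctProb_le_inv_card {t : ℕ} (ht : t < n) (hs : epochStart n m t = t) :
    correctProb G ω t ≤ ((n - t : ℕ) : ℝ)⁻¹ := by
  refine correctProb_le_inv G ω ht (by exact_mod_cast Nat.sub_pos_of_lt ht) fun h hh => ?_
  have h1 := card_mtbChoices_ge (m := m) hh ht.le
  rw [hs] at h1
  exact_mod_cast (by omega : n - t ≤ (mtbChoices n m h).card)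

theorem correctProb_le_inv_epochLength {t : ℕ} (hl : 0 < epochLength n m)
    (ht : 2 * epochLength n m < n - t) : correctProb G ω t ≤ (epochLength n m : ℝ)⁻¹ := by
  refine correctProb_le_inv G ω (by omega) (by exact_mod_cast hl) fun h hh => ?_
  have h1 := card_mtbChoices_ge (m := m) hh (by omega)
  have h2 : t - epochStart n m t ≤ epochLength n m := by
    rw [epochStart]
    split_ifs
    · have := Nat.mod_lt (firstEpoch n - (n - t)) hl
      omega
    · omega
  exact_mod_cast (by omega : epochLength n m ≤ (mtbChoices n m h).card)

omit [NeZero n] in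
theorem sum_range_sub_eq (φ : ℕ → ℝ) {J : ℕ} (hJ : J ≤ n) :
    ∑ i ∈ Finset.range J, φ (n - (n - J + i)) = ∑ j ∈ Finset.range J, φ (j + 1) := by
  rw [← Finset.sum_range_reflect (fun j => φ (j + 1))]
  refine Finset.sum_congr rfl fun i hi => ?_
  have := Finset.mem_range.1 hi
  congr 1
  omega

theorem sum_inv_add_one (J : ℕ) :
    ∑ j ∈ Finset.range J, ((j + 1 : ℕ) : ℝ)⁻¹ = (harmonic J : ℝ) := by
  rw [harmonic]; push_cast; rfl

/-- The turns before the first epoch. -/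
theorem sum_correctProb_shuffle_le :
    ∑ t ∈ Finset.range (n - firstEpoch n), correctProb G ω t ≤
      1 + Real.log n - Real.log (firstEpoch n + 1) := by
  have hkn : firstEpoch n ≤ n := Nat.div_le_self _ _
  set k := firstEpoch n
  have h1 : ∑ t ∈ Finset.range (n - k), correctProb G ω t ≤
      ∑ t ∈ Finset.range (n - k), ((n - t : ℕ) : ℝ)⁻¹ := by
    refine Finset.sum_le_sum fun t ht => ?_
    have := Finset.mem_range.1 ht
    refine correctProb_le_inv_card G ω (by omega) ?_
    rw [epochStart, if_neg]
    omega
  have h2 := sum_range_sub_eq (n := n) (fun t => (t : ℝ)⁻¹) le_rfl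
  have h3 := sum_range_sub_eq (n := n) (fun t => (t : ℝ)⁻¹) hkn
  rw [sum_inv_add_one] at h2 h3
  simp only [Nat.sub_self, zero_add] at h2
  have h4 := Finset.sum_range_add (fun t => ((n - t : ℕ) : ℝ)⁻¹) (n - k) k
  rw [show n - k + k = n by omega, h2, h3] at h4
  have h5 := harmonic_le_one_add_log n
  have h6 := log_add_one_le_harmonic k
  push_cast at h6
  linarith

/-- The turns after the epochs that begin with at least `4 ℓ` cards. -/
theorem sum_correctProb_end_le (hl : 0 < epochLength n m) {J : ℕ} (hJn : J ≤ n)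
    (hJ : J ≤ 4 * epochLength n m) :
    ∑ i ∈ Finset.range J, correctProb G ω (n - J + i) ≤
      3 + Real.log (2 * epochLength n m) := by
  set l := epochLength n m
  have hl' : (0 : ℝ) < l := by exact_mod_cast hl
  set φ : ℕ → ℝ := fun t => if t ≤ 2 * l then (t : ℝ)⁻¹ else (l : ℝ)⁻¹ with hφ
  have hφ0 : ∀ t, 0 ≤ φ t := fun t => by simp only [hφ]; split_ifs <;> positivity
  calc _ ≤ ∑ i ∈ Finset.range J, φ (n - (n - J + i)) := by
        refine Finset.sum_le_sum fun i hi => ?_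
        have := Finset.mem_range.1 hi
        simp only [hφ]
        split_ifs with h
        · refine correctProb_le_inv_card G ω (by omega) ?_
          rw [epochStart, if_neg]
          omega
        · exact correctProb_le_inv_epochLength G ω hl (by omega)
    _ = ∑ j ∈ Finset.range J, φ (j + 1) := sum_range_sub_eq φ hJn
    _ ≤ ∑ j ∈ Finset.range (2 * l + 2 * l), φ (j + 1) :=
        Finset.sum_le_sum_of_subset_of_nonneg (Finset.range_subset_range.2 (by omega))
          fun _ _ _ => hφ0 _
    _ = (harmonic (2 * l) : ℝ) + ∑ j ∈ Finset.range (2 * l), (l : ℝ)⁻¹ := by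
        rw [Finset.sum_range_add, ← sum_inv_add_one]
        congr 1
        · refine Finset.sum_congr rfl fun j hj => ?_
          have := Finset.mem_range.1 hj
          simp only [hφ]
          rw [if_pos (by omega)]
        · refine Finset.sum_congr rfl fun j hj => ?_
          simp only [hφ]
          rw [if_neg (by omega)]
    _ ≤ _ := by
        have h1 := harmonic_le_one_add_log (2 * l)
        rw [Finset.sum_const, Finset.card_range, nsmul_eq_mul]
        push_cast at h1 ⊢
        rw [mul_assoc, mul_inv_cancel₀ hl'.ne']
        linarith

/-- The epochs that begin with at least `4 ℓ` cards. -/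
theorem sum_correctProb_epochs_le (hn : 2 ≤ n) (hm : 1 ≤ m) {E : ℕ}
    (hE : (E + 3) * epochLength n m ≤ firstEpoch n) :
    ∑ i ∈ Finset.range (E * epochLength n m), correctProb G ω (n - firstEpoch n + i) ≤ 2 := by
  have hL : 0 < Nat.clog 2 n := Nat.clog_pos one_lt_two (by omega)
  have hkn : firstEpoch n ≤ n := Nat.div_le_self _ _
  have hl0 : 0 < epochLength n m := Nat.mul_pos hm hL
  have hlL : (epochLength n m : ℝ) = m * Nat.clog 2 n := by rw [epochLength]; push_cast; rfl
  have hnL : (n : ℝ) ≤ 2 ^ Nat.clog 2 n := by exact_mod_cast Nat.le_pow_clog one_lt_two n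
  set k := firstEpoch n
  set l := epochLength n m
  set L := Nat.clog 2 n
  have hl : (1 : ℝ) ≤ l := by exact_mod_cast hl0
  have hL' : (0 : ℝ) < L := by exact_mod_cast hL
  have hm' : (0 : ℝ) < m := by exact_mod_cast hm
  have hE' : ((E : ℝ) + 3) * l ≤ k := by exact_mod_cast hE
  have hEl : (0 : ℝ) ≤ E * l := by positivity
  have h1 : ∀ a ≤ E, ∑ i ∈ Finset.range (a * l), correctProb G ω (n - k + i) ≤
      ∑ i ∈ Finset.range a, 2 * m / l * (l / ((k : ℝ) - i * l - 2 * l)) := by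
    intro a ha
    induction a with
    | zero => simp
    | succ a ih =>
      have h2 := (Nat.mul_le_mul_right l (by omega : a + 4 ≤ E + 3)).trans hE
      have h3 : a * l + 4 * l ≤ k := by rw [← add_mul]; exact h2
      have h4 : (a : ℝ) * l + 4 * l ≤ k := by exact_mod_cast h3
      have h5 : ((n - (n - k + a * l) : ℕ) : ℝ) = k - a * l := by
        rw [show n - (n - k + a * l) = k - a * l by omega, Nat.cast_sub (by omega)]
        push_cast; rfl
      rw [add_mul, one_mul, Finset.sum_range_add, Finset.sum_range_succ]
      refine add_le_add (ih (by omega)) ?_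
      have hpos : (0 : ℝ) < k - a * l - 2 * l := by linarith
      have hend : 3 * l ≤ n - (n - k + a * l) := by omega
      calc _ ≤ ∑ i ∈ Finset.range l, ((k : ℝ) - a * l - 2 * l)⁻¹ *
            hitProb G ω (n - k + a * l + i) := by
            refine Finset.sum_le_sum fun i hi => ?_
            have hi' := Finset.mem_range.1 hi
            rw [← add_assoc]
            refine correctProb_le G ω (by omega) hpos fun h hh => ?_
            have := card_mtbChoices_ge_of_epoch (m := m) rfl hend hi' hh
            rwa [h5] at this
        _ ≤ ((k : ℝ) - a * l - 2 * l)⁻¹ * (2 * m) := by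
            rw [← Finset.mul_sum]
            exact mul_le_mul_of_nonneg_left (sum_hitProb_le G ω hn hm a h2) (by positivity)
        _ = _ := by field_simp
  refine (h1 E le_rfl).trans ?_
  rw [← Finset.mul_sum]
  have h2 := sum_epoch_le_log (k := k) (l := l) (by linarith) E (by linarith)
  have h3 : Real.log (((k : ℝ) - 2 * l) / (k - E * l - 2 * l)) ≤ L * Real.log 2 := by
    rw [← Real.log_pow]
    refine Real.log_le_log (div_pos (by linarith) (by linarith)) (le_trans ?_ hnL)
    rw [div_le_iff₀ (by linarith)]
    have : (k : ℝ) ≤ n := by exact_mod_cast hkn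
    nlinarith
  calc _ ≤ 2 * m / l * (L * Real.log 2) :=
        mul_le_mul_of_nonneg_left (h2.trans h3) (by positivity)
    _ = 2 * Real.log 2 := by rw [hlL]; field_simp
    _ ≤ 2 := by linarith [Real.log_two_lt_d9]

theorem expect_correct_le (hn : 2 ≤ n) (hm : 1 ≤ m) :
    expect (mtbDealer n m) G ω n (fun x => (correct x.2 : ℝ)) ≤
      Real.log m + 2 * Real.log (Real.logb 2 n) + (9 + Real.log 22) := by
  have hL : 0 < Nat.clog 2 n := Nat.clog_pos one_lt_two (by omega)
  have hkn : firstEpoch n ≤ n := Nat.div_le_self _ _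
  have hl0 : 0 < epochLength n m := Nat.mul_pos hm hL
  have hlL : (epochLength n m : ℝ) = m * Nat.clog 2 n := by rw [epochLength]; push_cast; rfl
  have hm' : (0 : ℝ) < m := by exact_mod_cast hm
  have hn' : (0 : ℝ) < n := by exact_mod_cast (by omega : 0 < n)
  have hL' : (0 : ℝ) < Nat.clog 2 n := by exact_mod_cast hL
  -- `L ≤ 2 * log₂ n`
  have hlogb : 1 ≤ Real.logb 2 n := by
    rw [Real.le_logb_iff_rpow_le one_lt_two hn', Real.rpow_one]
    exact_mod_cast hn
  have hLlogb : (Nat.clog 2 n : ℝ) ≤ 2 * Real.logb 2 n := by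
    have h1 : ((Nat.clog 2 n - 1 : ℕ) : ℝ) ≤ Real.logb 2 n := by
      rw [Real.le_logb_iff_rpow_le one_lt_two hn', Real.rpow_natCast]
      exact_mod_cast (Nat.pow_pred_clog_lt_self one_lt_two (by omega)).le
    rw [Nat.cast_sub hL, Nat.cast_one] at h1
    linarith
  have hlogL : Real.log (Nat.clog 2 n) ≤ Real.log 2 + Real.log (Real.logb 2 n) := by
    rw [← Real.log_mul two_ne_zero (by linarith)]
    exact Real.log_le_log hL' hLlogb
  have h1 := sum_correctProb_shuffle_le (m := m) G ω
  have hk1 : Real.log n - Real.log (firstEpoch n + 1) ≤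
      Real.log 22 + Real.log (Nat.clog 2 n) := by
    rw [← Real.log_mul (by norm_num) hL'.ne', ← Real.log_div hn'.ne' (by positivity)]
    refine Real.log_le_log (by positivity) ?_
    rw [div_le_iff₀ (by positivity)]
    have h2 := (Nat.lt_mul_div_succ n (by positivity : 0 < 22 * Nat.clog 2 n)).le
    rw [firstEpoch, ceil_eight_mul_exp_one]
    exact_mod_cast h2
  set l := epochLength n m
  set k := firstEpoch n
  -- the number of epochs that begin with at least `4 ℓ` cards
  set E := k / l - 3 with hE
  have hdiv := Nat.div_add_mod k l
  have hmod := Nat.mod_lt k hl0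
  obtain ⟨h2, hJ, hEk⟩ : ∑ i ∈ Finset.range (E * l), correctProb G ω (n - k + i) ≤ 2 ∧
      k - E * l ≤ 4 * l ∧ E * l ≤ k := by
    rcases Nat.lt_or_ge (k / l) 3 with h | h
    · have hE0 : E = 0 := by omega
      have := Nat.mul_le_mul_left l h
      rw [hE0]
      simp only [zero_mul, Finset.range_zero, Finset.sum_empty]
      refine ⟨by norm_num, ?_, by omega⟩
      rw [Nat.succ_eq_add_one, mul_add] at this
      omega
    · have hE3 : (E + 3) * l ≤ k := by
        rw [hE, Nat.sub_add_cancel h]; exact Nat.div_mul_le_self _ _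
      refine ⟨sum_correctProb_epochs_le G ω hn hm hE3, ?_, ?_⟩
      · have h4 : l * (k / l) = E * l + 3 * l := by
          rw [← add_mul, hE, Nat.sub_add_cancel h, mul_comm]
        omega
      · rw [add_mul] at hE3; omega
  have h3 := sum_correctProb_end_le G ω hl0 (J := k - E * l) (by omega) hJ
  have hl2 : Real.log (2 * l) = Real.log 2 + (Real.log m + Real.log (Nat.clog 2 n)) := by
    rw [hlL, Real.log_mul two_ne_zero (by positivity), Real.log_mul hm'.ne' hL'.ne']
  have hsum : expect (mtbDealer n m) G ω n (fun x => (correct x.2 : ℝ)) =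
      ∑ t ∈ Finset.range (n - k), correctProb G ω t +
        (∑ i ∈ Finset.range (E * l), correctProb G ω (n - k + i) +
          ∑ i ∈ Finset.range (k - E * l), correctProb G ω (n - (k - E * l) + i)) := by
    rw [expect_correct]
    have e1 := Finset.sum_range_add (correctProb G ω) (n - k) (E * l + (k - E * l))
    rw [show n - k + (E * l + (k - E * l)) = n by omega,
      Finset.sum_range_add _ (E * l) (k - E * l)] at e1
    simp only [show ∀ i, n - (k - E * l) + i = n - k + (E * l + i) by omega]
    exact e1
  rw [hsum]
  linarith [Real.log_two_lt_d9]

end Hits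

/-- The bound holds for every outcome of the Guesser's randomness. -/
theorem expectedCorrect_mtbDealer_le {n m : ℕ} [NeZero n] (hn : 2 ≤ n) (hm : 1 ≤ m) {Ω : Type*}
    [MeasurableSpace Ω] (P : MeasureTheory.Measure Ω) [MeasureTheory.IsProbabilityMeasure P]
    (G : Guesser Ω n m) :
    expectedCorrect P (mtbDealer n m) G ≤
      ENNReal.ofReal (Real.log m + 2 * Real.log (Real.logb 2 n) + (9 + Real.log 22)) := by
  rw [expectedCorrect]
  calc _ ≤ ∫⁻ _, ENNReal.ofReal
        (Real.log m + 2 * Real.log (Real.logb 2 n) + (9 + Real.log 22)) ∂P := by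
        refine MeasureTheory.lintegral_mono fun ω => ?_
        have h1 := tsum_play_mul (mtbDealer n m) G ω n (fun x => (correct x.2 : ℝ))
          fun _ => by positivity
        simp only [ENNReal.ofReal_natCast] at h1
        simp only [h1]
        exact ENNReal.ofReal_le_ofReal (expect_correct_le G ω hn hm)
    _ = _ := by simp

/-! ### Running times of programs -/

section Machine

/-- The program `p` leads from memory `σ` to memory `τ` in at most `b` steps. -/
def Runs (p : Prog) (σ : Mem) (b : ℕ) (τ : Mem) : Prop := ∃ T ≤ b, Exec p σ T τ

theorem Runs.mono {p : Prog} {σ τ : Mem} {a b : ℕ} (h : Runs p σ a τ) (hab : a ≤ b) :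
    Runs p σ b τ :=
  let ⟨T, hT, hp⟩ := h
  ⟨T, hT.trans hab, hp⟩

theorem Runs.seq {p q : Prog} {σ τ υ : Mem} {a b : ℕ} (hp : Runs p σ a τ) (hq : Runs q τ b υ) :
    Runs (.seq p q) σ (a + b) υ :=
  let ⟨_, hS, hp⟩ := hp
  let ⟨_, hT, hq⟩ := hq
  ⟨_, Nat.add_le_add hS hT, .seq hp hq⟩

theorem Runs.ite_pos {x : ℕ} {p q : Prog} {σ τ : Mem} {a : ℕ} (hx : 0 < σ.var x)
    (hp : Runs p σ a τ) : Runs (.ite x p q) σ (a + 1) τ :=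
  let ⟨_, hT, hp⟩ := hp
  ⟨_, Nat.add_le_add_right hT 1, .ite_pos hx hp⟩

theorem Runs.ite_zero {x : ℕ} {p q : Prog} {σ τ : Mem} {a : ℕ} (hx : σ.var x = 0)
    (hq : Runs q σ a τ) : Runs (.ite x p q) σ (a + 1) τ :=
  let ⟨_, hT, hq⟩ := hq
  ⟨_, Nat.add_le_add_right hT 1, .ite_zero hx hq⟩

/-- A loop with `k` iterations, where `st i` is the memory after `i` of them. -/
theorem Runs.loop {x : ℕ} {p : Prog} {a : ℕ} (st : ℕ → Mem) (k : ℕ)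
    (hpos : ∀ i < k, 0 < (st i).var x) (hzero : (st k).var x = 0)
    (hstep : ∀ i < k, Runs p (st i) a (st (i + 1))) :
    Runs (.loop x p) (st 0) (k * (a + 1) + 1) (st k) := by
  induction k generalizing st with
  | zero => exact ⟨1, by omega, .loop_zero hzero⟩
  | succ k ih =>
    obtain ⟨S, hS, hp⟩ := hstep 0 (by omega)
    obtain ⟨T, hT, hq⟩ := ih (fun i => st (i + 1)) (fun i hi => hpos (i + 1) (by omega)) hzero
      fun i hi => hstep (i + 1) (by omega)
    refine ⟨S + T + 1, ?_, .loop_pos (hpos 0 (by omega)) hp hq⟩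
    rw [Nat.add_one_mul]
    omega

/-- The part of the memory that a program may change: twelve variables, as a list, and array 3. -/
abbrev Work : Type := List ℕ × (ℕ → ℕ)

/-- The memory with the working part `s` and with the arrays `I`, except for array 3. -/
def ram (I : ℕ → ℕ → ℕ) (s : Work) : Mem where
  var x := s.1.getD x 0
  arr a i := if a = 3 then s.2 i else I a i

/-- Programs without branching that use only twelve variables and write only to array 3. -/
def Straight : Prog → Prop
  | .const x _ => x < 12
  | .add x _ _ => x < 12
  | .sub x _ _ => x < 12
  | .load x _ _ => x < 12
  | .store a _ _ => a = 3
  | .seq p q => Straight p ∧ Straight q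
  | .ite _ _ _ => False
  | .loop _ _ => False

/-- The effect of a program without branching. -/
def effect (I : ℕ → ℕ → ℕ) : Prog → Work → Work
  | .const x c, s => (s.1.set x c, s.2)
  | .add x y z, s => (s.1.set x (s.1.getD y 0 + s.1.getD z 0), s.2)
  | .sub x y z, s => (s.1.set x (s.1.getD y 0 - s.1.getD z 0), s.2)
  | .load x a y, s => (s.1.set x (if a = 3 then s.2 (s.1.getD y 0) else I a (s.1.getD y 0)), s.2)
  | .store _ y x, s => (s.1, Function.update s.2 (s.1.getD y 0) (s.1.getD x 0))
  | .seq p q, s => effect I q (effect I p s)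
  | .ite _ _ _, s => s
  | .loop _ _, s => s

/-- The number of instructions of a program without branching. -/
def size : Prog → ℕ
  | .seq p q => size p + size q
  | _ => 1

theorem setVar_ram (I : ℕ → ℕ → ℕ) (s : Work) {x : ℕ} (hx : x < s.1.length) (c : ℕ) :
    (ram I s).setVar x c = ram I (s.1.set x c, s.2) := by
  simp only [Mem.setVar, ram, Mem.mk.injEq, and_true]
  funext y
  by_cases h : y = x
  · subst h; simp [hx]
  · simp [Function.update_of_ne h, Ne.symm h]

theorem setArr_ram (I : ℕ → ℕ → ℕ) (s : Work) (i c : ℕ) :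
    (ram I s).setArr 3 i c = ram I (s.1, Function.update s.2 i c) := by
  simp only [Mem.setArr, ram, Mem.mk.injEq, true_and]
  funext a j
  by_cases h : a = 3
  · subst h; simp [Function.update_apply]
  · simp [h]

theorem length_effect (I : ℕ → ℕ → ℕ) (p : Prog) (s : Work) :
    (effect I p s).1.length = s.1.length := by
  induction p generalizing s with
  | seq p q hp hq => rw [effect, hq, hp]
  | _ => simp [effect]

theorem runs_effect (I : ℕ → ℕ → ℕ) {p : Prog} (hp : Straight p) {s : Work}
    (hs : s.1.length = 12) : Runs p (ram I s) (size p) (ram I (effect I p s)) := by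
  induction p generalizing s with
  | const x c => rw [effect, ← setVar_ram I s (hs ▸ hp)]; exact ⟨1, le_rfl, .const x c _⟩
  | add x y z => rw [effect, ← setVar_ram I s (hs ▸ hp)]; exact ⟨1, le_rfl, .add x y z _⟩
  | sub x y z => rw [effect, ← setVar_ram I s (hs ▸ hp)]; exact ⟨1, le_rfl, .sub x y z _⟩
  | load x a y => rw [effect, ← setVar_ram I s (hs ▸ hp)]; exact ⟨1, le_rfl, .load x a y _⟩
  | store a y x =>
    obtain rfl : a = 3 := hp
    rw [effect, ← setArr_ram I s]; exact ⟨1, le_rfl, .store 3 y x _⟩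
  | seq p q ihp ihq => exact (ihp hp.1 hs).seq (ihq hp.2 (by rw [length_effect, hs]))
  | ite => exact hp.elim
  | loop => exact hp.elim

/-- A block of instructions without branching. -/
theorem runs_block (I : ℕ → ℕ → ℕ) {p : Prog} {s s' : Work} (hp : Straight p)
    (hs : s.1.length = 12) (h : effect I p s = s') : Runs p (ram I s) (size p) (ram I s') :=
  h ▸ runs_effect I hp hs

/-- A loop whose body has no branching, where `st i` is the working part of the memory after `i`
iterations. -/
theorem runs_loop (I : ℕ → ℕ → ℕ) {x : ℕ} {p : Prog} (hp : Straight p) (st : ℕ → Work) (k : ℕ)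
    (hs : ∀ i, (st i).1.length = 12) (hpos : ∀ i < k, 0 < (st i).1.getD x 0)
    (hzero : (st k).1.getD x 0 = 0) (hstep : ∀ i < k, effect I p (st i) = st (i + 1)) :
    Runs (.loop x p) (ram I (st 0)) (k * (size p + 1) + 1) (ram I (st k)) :=
  Runs.loop (fun i => ram I (st i)) k hpos hzero fun i hi =>
    runs_block I hp (hs i) (hstep i hi)

end Machine

/-! ### A program for the Move-to-the-Back Dealer -/

/-!
Variables 0 to 2 hold `n`, `m` and the number `len` of turns played, 3 holds `⌈log₂ n⌉`, 4 powers
of two and then the divisor in the definition of `firstEpoch`, 5 holds `firstEpoch n`, 6 holds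
`epochLength n m`, 7 a counter, 8 the number of cards left and then a count of cards, 9 the
constant 1, 10 is scratch, and 11 holds the number of turns of the current epoch that have been
played. Array 3 marks the cards outside of `mtbChoices`.
-/

section Program

variable (I : ℕ → ℕ → ℕ) (n m len : ℕ)

/-- Computes `⌈log₂ n⌉`. -/
def progLog : Prog :=
  .seq (.seq (.const 9 1) (.seq (.const 4 1) (.sub 7 0 4)))
    (.loop 7 (.seq (.add 4 4 4) (.seq (.add 3 3 9) (.sub 7 0 4))))

theorem runs_progLog (f : ℕ → ℕ) :
    Runs progLog (ram I ([n, m, len, 0, 0, 0, 0, 0, 0, 0, 0, 0], f)) (4 * n + 4)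
      (ram I ([n, m, len, Nat.clog 2 n, 2 ^ Nat.clog 2 n, 0, 0, 0, 0, 1, 0, 0], f)) := by
  have hL : Nat.clog 2 n ≤ n := Nat.clog_le_of_le_pow Nat.lt_two_pow_self.le
  have h0 : n - 2 ^ Nat.clog 2 n = 0 := Nat.sub_eq_zero_of_le (Nat.le_pow_clog one_lt_two n)
  have h2 := runs_loop I (x := 7) (p := .seq (.add 4 4 4) (.seq (.add 3 3 9) (.sub 7 0 4)))
    (by simp [Straight])
    (fun i => ([n, m, len, i, 2 ^ i, 0, 0, n - 2 ^ i, 0, 1, 0, 0], f)) (Nat.clog 2 n)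
    (fun i => rfl) (fun i hi => Nat.sub_pos_of_lt (Nat.pow_lt_of_lt_clog hi)) h0
    (fun i hi => by simp [effect, pow_succ, mul_two])
  simp only [h0] at h2
  refine (Runs.seq (runs_block I (by simp [Straight]) rfl ?_) h2).mono ?_
  · simp [effect]
  · simp only [size]; omega

/-- Computes `c * ⌈log₂ n⌉`. -/
def progDivisor (c : ℕ) : Prog :=
  .seq (.seq (.const 4 0) (.const 7 c)) (.loop 7 (.seq (.add 4 4 3) (.sub 7 7 9)))

theorem runs_progDivisor (c L d : ℕ) (f : ℕ → ℕ) :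
    Runs (progDivisor c) (ram I ([n, m, len, L, d, 0, 0, 0, 0, 1, 0, 0], f)) (3 * c + 3)
      (ram I ([n, m, len, L, c * L, 0, 0, 0, 0, 1, 0, 0], f)) := by
  have h2 := runs_loop I (x := 7) (p := .seq (.add 4 4 3) (.sub 7 7 9)) (by simp [Straight])
    (fun i => ([n, m, len, L, i * L, 0, 0, c - i, 0, 1, 0, 0], f)) c
    (fun i => rfl) (fun i hi => Nat.sub_pos_of_lt hi) (Nat.sub_self c)
    (fun i hi => by simp [effect, add_mul, Nat.sub_sub])
  simp only [Nat.sub_self] at h2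
  refine (Runs.seq (runs_block I (by simp [Straight]) rfl ?_) h2).mono ?_
  · simp [effect]
  · simp only [size]; omega

/-- Computes `epochLength n m`. -/
def progLength : Prog :=
  .seq (.add 7 1 6) (.loop 7 (.seq (.add 6 6 3) (.sub 7 7 9)))

theorem runs_progLength (L d : ℕ) (f : ℕ → ℕ) :
    Runs progLength (ram I ([n, m, len, L, d, 0, 0, 0, 0, 1, 0, 0], f)) (3 * m + 2)
      (ram I ([n, m, len, L, d, 0, m * L, 0, 0, 1, 0, 0], f)) := by
  have h2 := runs_loop I (x := 7) (p := .seq (.add 6 6 3) (.sub 7 7 9)) (by simp [Straight])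
    (fun i => ([n, m, len, L, d, 0, i * L, m - i, 0, 1, 0, 0], f)) m
    (fun i => rfl) (fun i hi => Nat.sub_pos_of_lt hi) (Nat.sub_self m)
    (fun i hi => by simp [effect, add_mul, Nat.sub_sub])
  simp only [Nat.sub_self] at h2
  refine (Runs.seq (runs_block I (by simp [Straight]) rfl ?_) h2).mono ?_
  · simp [effect]
  · simp only [size]; omega

/-- Divides `n` by variable 4. -/
def progFirst : Prog :=
  .ite 4
    (.seq (.seq (.add 7 0 9) (.sub 7 7 4)) (.loop 7 (.seq (.add 5 5 9) (.sub 7 7 4))))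
    (.const 7 0)

theorem runs_progFirst (L d l : ℕ) (f : ℕ → ℕ) :
    Runs progFirst (ram I ([n, m, len, L, d, 0, l, 0, 0, 1, 0, 0], f)) (3 * n + 4)
      (ram I ([n, m, len, L, d, n / d, l, 0, 0, 1, 0, 0], f)) := by
  rcases Nat.eq_zero_or_pos d with rfl | hd
  · refine Runs.mono (Runs.ite_zero rfl (runs_block I (by simp [Straight]) rfl ?_))
      (by simp only [size]; omega)
    simp [effect]
  · have hmul : ∀ i, (i + 1) * d ≤ n ↔ i < n / d := fun i => by
      rw [← Nat.le_div_iff_mul_le hd, Nat.succ_le_iff]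
    have hle := Nat.div_le_self n d
    have h0 : n + 1 - (n / d + 1) * d = 0 := by
      have := (hmul (n / d)).not.2 (lt_irrefl _); omega
    have h2 := runs_loop I (x := 7) (p := .seq (.add 5 5 9) (.sub 7 7 4)) (by simp [Straight])
      (fun i => ([n, m, len, L, d, i, l, n + 1 - (i + 1) * d, 0, 1, 0, 0], f)) (n / d)
      (fun i => rfl) (fun i hi => by
        have := (hmul i).2 hi
        show 0 < n + 1 - (i + 1) * d
        omega) h0
      (fun i hi => by simp [effect, add_mul, Nat.sub_sub])
    simp only [h0] at h2
    refine Runs.mono (Runs.ite_pos hd (Runs.seq (runs_block I (by simp [Straight]) rfl ?_) h2)) ?_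
    · simp [effect]
    · simp only [size]; omega

/-- Computes the number of turns of the current epoch that have been played; outside of the epochs
it is 0. -/
def progEpoch : Prog :=
  .seq (.seq (.seq (.sub 8 0 2) (.seq (.sub 10 8 6) (.seq (.sub 10 10 6)
      (.seq (.add 11 5 9) (.sub 11 11 8)))))
    (.ite 10 (.ite 11 (.ite 6
        (.seq (.seq (.sub 10 11 6) (.loop 10 (.seq (.sub 11 11 6) (.sub 10 11 6)))) (.sub 11 11 9))
        (.const 11 0)) (.const 11 0)) (.const 11 0)))
    (.const 10 0)

theorem runs_progEpoch (L d k l : ℕ) (f : ℕ → ℕ) :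
    Runs progEpoch (ram I ([n, m, len, L, d, k, l, 0, 0, 1, 0, 0], f)) (3 * k + 12)
      (ram I ([n, m, len, L, d, k, l, 0, n - len, 1, 0,
        if 2 * l < n - len ∧ n - len ≤ k ∧ 0 < l then (k - (n - len)) % l else 0], f)) := by
  set t := n - len with ht
  have h1 : Runs (.seq (.sub 8 0 2) (.seq (.sub 10 8 6) (.seq (.sub 10 10 6)
      (.seq (.add 11 5 9) (.sub 11 11 8)))))
      (ram I ([n, m, len, L, d, k, l, 0, 0, 1, 0, 0], f)) 5
      (ram I ([n, m, len, L, d, k, l, 0, t, 1, t - l - l, k + 1 - t], f)) :=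
    runs_block I (by simp [Straight]) rfl (by simp [effect, ht])
  have hclear : ∀ a x, Runs (.const 10 0) (ram I ([n, m, len, L, d, k, l, 0, t, 1, a, x], f)) 1
      (ram I ([n, m, len, L, d, k, l, 0, t, 1, 0, x], f)) := fun a x =>
    runs_block I (by simp [Straight]) rfl (by simp [effect])
  have hzero : ∀ a x, Runs (.const 11 0) (ram I ([n, m, len, L, d, k, l, 0, t, 1, a, x], f)) 1
      (ram I ([n, m, len, L, d, k, l, 0, t, 1, a, 0], f)) := fun a x =>
    runs_block I (by simp [Straight]) rfl (by simp [effect])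
  rcases Nat.eq_zero_or_pos (t - l - l) with hc1 | hc1
  · rw [if_neg (by omega)]
    exact ((h1.seq (Runs.ite_zero (x := 10) hc1 (hzero _ _))).seq (hclear _ _)).mono (by omega)
  rcases Nat.eq_zero_or_pos (k + 1 - t) with hc2 | hc2
  · rw [if_neg (by omega)]
    exact ((h1.seq (Runs.ite_pos (x := 10) hc1 (Runs.ite_zero (x := 11) hc2 (hzero _ _)))).seq
      (hclear _ _)).mono (by omega)
  rcases Nat.eq_zero_or_pos l with hc3 | hc3
  · rw [if_neg (by omega)]
    exact ((h1.seq (Runs.ite_pos (x := 10) hc1 (Runs.ite_pos (x := 11) hc2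
      (Runs.ite_zero (x := 6) hc3 (hzero _ _))))).seq (hclear _ _)).mono (by omega)
  rw [if_pos (by omega)]
  obtain ⟨y, hy⟩ : ∃ y, k = y + t := ⟨k - t, by omega⟩
  have hmul : ∀ i, (i + 1) * l ≤ y ↔ i < y / l := fun i => by
    rw [← Nat.le_div_iff_mul_le hc3, Nat.succ_le_iff]
  have hle := Nat.div_le_self y l
  have hdiv := Nat.div_add_mod y l
  have hmod := Nat.mod_lt y hc3
  rw [mul_comm] at hdiv
  have h2 := runs_loop I (x := 10) (p := .seq (.sub 11 11 6) (.sub 10 11 6))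
    (by simp [Straight])
    (fun i => ([n, m, len, L, d, k, l, 0, t, 1, y + 1 - (i + 1) * l, y + 1 - i * l], f)) (y / l)
    (fun i => rfl) (fun i hi => by
      have := (hmul i).2 hi
      show 0 < y + 1 - (i + 1) * l
      omega)
    (by
      show y + 1 - (y / l + 1) * l = 0
      rw [add_mul]; omega)
    (fun i hi => by simp [effect, add_mul, Nat.sub_sub])
  have h3 : Runs (.sub 10 11 6)
      (ram I ([n, m, len, L, d, k, l, 0, t, 1, t - l - l, k + 1 - t], f)) 1
      (ram I ([n, m, len, L, d, k, l, 0, t, 1, y + 1 - (0 + 1) * l, y + 1 - 0 * l], f)) :=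
    runs_block I (by simp [Straight]) rfl (by simp [effect]; omega)
  have h4 : Runs (.sub 11 11 9) (ram I ([n, m, len, L, d, k, l, 0, t, 1,
        y + 1 - (y / l + 1) * l, y + 1 - y / l * l], f)) 1
      (ram I ([n, m, len, L, d, k, l, 0, t, 1, y + 1 - (y / l + 1) * l, (k - t) % l], f)) :=
    runs_block I (by simp [Straight]) rfl (by
      have : k - t = y := by omega
      simp [effect, this]; omega)
  refine ((h1.seq (Runs.ite_pos (x := 10) hc1 (Runs.ite_pos (x := 11) hc2 (Runs.ite_pos (x := 6) hc3
    ((h3.seq h2).seq h4))))).seq (hclear _ _)).mono ?_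
  simp only [size]
  omega

/-- The marks after the entries of the array `g` at the last `i` of the positions below `len` have
been marked. -/
def markLast (g f : ℕ → ℕ) : ℕ → ℕ → ℕ
  | 0 => f
  | i + 1 => Function.update (markLast g f i) (g (len - (i + 1))) 1

theorem markLast_eq_zero_iff (g f : ℕ → ℕ) (i j : ℕ) (hi : i ≤ len) :
    markLast len g f i j = 0 ↔ f j = 0 ∧ ∀ i', len - i ≤ i' → i' < len → g i' ≠ j := by
  induction i with
  | zero =>
    simp only [markLast, Nat.sub_zero, iff_self_and]
    intro _ i' h1 h2
    omega
  | succ i ih =>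
    rw [markLast, Function.update_apply]
    split_ifs with h
    · simp only [false_iff, not_and, not_forall]
      exact fun _ => ⟨len - (i + 1), le_rfl, by omega, fun h' => h' h.symm⟩
    · rw [ih (by omega)]
      refine and_congr_right fun _ => ⟨fun H i' h1 h2 => ?_, fun H i' h1 h2 => H i' (by omega) h2⟩
      rcases Nat.eq_or_lt_of_le h1 with h3 | h3
      · exact fun h4 => h (by rw [h3]; exact h4.symm)
      · exact H i' (by omega) h2

/-- Marks the cards drawn. -/
def progDraws : Prog :=
  .seq (.add 7 2 10)
    (.loop 7 (.seq (.sub 7 7 9) (.seq (.load 10 1 7) (.seq (.store 3 10 9) (.const 10 0)))))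

theorem runs_progDraws (L d k l t x : ℕ) (f : ℕ → ℕ) :
    Runs progDraws (ram I ([n, m, len, L, d, k, l, 0, t, 1, 0, x], f)) (5 * len + 2)
      (ram I ([n, m, len, L, d, k, l, 0, t, 1, 0, x], markLast len (I 1) f len)) := by
  have h2 := runs_loop I (x := 7)
    (p := .seq (.sub 7 7 9) (.seq (.load 10 1 7) (.seq (.store 3 10 9) (.const 10 0))))
    (by simp [Straight])
    (fun i => ([n, m, len, L, d, k, l, len - i, t, 1, 0, x], markLast len (I 1) f i)) len
    (fun i => rfl) (fun i hi => Nat.sub_pos_of_lt hi) (Nat.sub_self len)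
    (fun i hi => by simp [effect, markLast, Nat.sub_sub])
  simp only [Nat.sub_self] at h2
  refine (Runs.seq (runs_block I (by simp [Straight]) rfl ?_) h2).mono ?_
  · simp [effect, markLast]
  · simp only [size]; omega

/-- Marks the cards guessed in the current epoch. -/
def progGuesses : Prog :=
  .seq (.add 7 2 10)
    (.loop 11 (.seq (.sub 7 7 9) (.seq (.load 10 0 7) (.seq (.store 3 10 9)
      (.seq (.const 10 0) (.sub 11 11 9))))))

theorem runs_progGuesses (L d k l t x : ℕ) (f : ℕ → ℕ) :
    Runs progGuesses (ram I ([n, m, len, L, d, k, l, 0, t, 1, 0, x], f)) (6 * x + 2)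
      (ram I ([n, m, len, L, d, k, l, len - x, t, 1, 0, 0], markLast len (I 0) f x)) := by
  have h2 := runs_loop I (x := 11)
    (p := .seq (.sub 7 7 9) (.seq (.load 10 0 7) (.seq (.store 3 10 9)
      (.seq (.const 10 0) (.sub 11 11 9)))))
    (by simp [Straight])
    (fun i => ([n, m, len, L, d, k, l, len - i, t, 1, 0, x - i], markLast len (I 0) f i)) x
    (fun i => rfl) (fun i hi => Nat.sub_pos_of_lt hi) (Nat.sub_self x)
    (fun i hi => by simp [effect, markLast, Nat.sub_sub])
  simp only [Nat.sub_self] at h2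
  refine (Runs.seq (runs_block I (by simp [Straight]) rfl ?_) h2).mono ?_
  · simp [effect, markLast]
  · simp only [size]; omega

/-- Counts the cards that are not marked. -/
def progCount : Prog :=
  .seq (.seq (.add 7 0 10) (.const 8 0))
    (.loop 7 (.seq (.sub 7 7 9) (.seq (.load 10 3 7) (.seq (.sub 10 9 10)
      (.seq (.add 8 8 10) (.const 10 0))))))

theorem count_add_one_eq (f : ℕ → ℕ) (j : ℕ) :
    Nat.count (fun j => f j = 0) (j + 1) = Nat.count (fun j => f j = 0) j + (1 - f j) := by
  rw [Nat.count_succ]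
  split_ifs <;> omega

theorem runs_progCount (L d k l b t : ℕ) (f : ℕ → ℕ) :
    Runs progCount (ram I ([n, m, len, L, d, k, l, b, t, 1, 0, 0], f)) (6 * n + 3)
      (ram I ([n, m, len, L, d, k, l, 0, Nat.count (fun j => f j = 0) n, 1, 0, 0], f)) := by
  set q := Nat.count (fun j => f j = 0) n
  have h2 := runs_loop I (x := 7)
    (p := .seq (.sub 7 7 9) (.seq (.load 10 3 7) (.seq (.sub 10 9 10)
      (.seq (.add 8 8 10) (.const 10 0)))))
    (by simp [Straight])
    (fun i => ([n, m, len, L, d, k, l, n - i, q - Nat.count (fun j => f j = 0) (n - i),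
      1, 0, 0], f)) n
    (fun i => rfl) (fun i hi => Nat.sub_pos_of_lt hi) (Nat.sub_self n)
    (fun i hi => by
      have h3 := count_add_one_eq f (n - (i + 1))
      rw [show n - (i + 1) + 1 = n - i by omega] at h3
      have h4 : Nat.count (fun j => f j = 0) (n - i) ≤ q := Nat.count_monotone _ (by omega)
      simp [effect, Nat.sub_sub]
      omega)
  simp only [Nat.sub_self, Nat.count_zero, Nat.sub_zero] at h2
  refine (Runs.seq (runs_block I (by simp [Straight]) rfl ?_) h2).mono ?_
  · simp [effect, q]
  · simp only [size]; omega

/-- Finds the card that is not marked and has `r` such cards below it, where `r` is the random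
number for the number of cards that are not marked. -/
def progFind : Prog :=
  .seq (.seq (.seq (.sub 8 8 9) (.seq (.load 8 2 8) (.seq (.add 8 8 9) (.const 7 0))))
    (.loop 8 (.seq (.load 10 3 7) (.seq (.sub 10 9 10) (.seq (.sub 8 8 10)
      (.seq (.const 10 0) (.add 7 7 9)))))))
    (.sub 0 7 9)

theorem runs_progFind (L d k l q c : ℕ) (f : ℕ → ℕ) (hc : f c = 0)
    (hr : Nat.count (fun j => f j = 0) c = I 2 (q - 1)) :
    Runs progFind (ram I ([n, m, len, L, d, k, l, 0, q, 1, 0, 0], f)) (6 * c + 12)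
      (ram I ([c, m, len, L, d, k, l, c + 1, 0, 1, 0, 0], f)) := by
  set r := I 2 (q - 1) with hrdef
  have hc1 : r + 1 - Nat.count (fun j => f j = 0) (c + 1) = 0 := by
    rw [Nat.count_succ, if_pos hc, hr, Nat.sub_self]
  have h2 := runs_loop I (x := 8)
    (p := .seq (.load 10 3 7) (.seq (.sub 10 9 10) (.seq (.sub 8 8 10)
      (.seq (.const 10 0) (.add 7 7 9)))))
    (by simp [Straight])
    (fun i => ([n, m, len, L, d, k, l, i, r + 1 - Nat.count (fun j => f j = 0) i,
      1, 0, 0], f)) (c + 1)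
    (fun i => rfl) (fun i hi => by
      have h4 : Nat.count (fun j => f j = 0) i ≤ _ := Nat.count_monotone _ (by omega : i ≤ c)
      show 0 < r + 1 - Nat.count (fun j => f j = 0) i
      omega) hc1
    (fun i hi => by
      have h3 := count_add_one_eq f i
      simp [effect, Nat.sub_sub, h3])
  simp only [hc1] at h2
  refine (Runs.seq (Runs.seq (runs_block I (by simp [Straight]) rfl ?_) h2)
    (runs_block I (by simp [Straight]) rfl ?_)).mono ?_
  · simp [effect, hrdef]
  · simp [effect]
  · simp only [size]; omega

end Program

/-! ### Efficiency -/

section Efficient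

/-- One coordinate of the random numbers, sent bijectively to the elements of `S`, is uniformly
distributed on `S`. -/
theorem map_uniformOfFintype_seed {n : ℕ} (k : Fin n) (S : Finset (Fin n)) (hS : S.Nonempty)
    (e : Fin (k.val + 1) → Fin n) (he : Function.Injective e) (heS : ∀ c, c ∈ S ↔ ∃ a, e a = c) :
    (PMF.uniformOfFintype (Seed n)).map (fun r => e (r k)) = PMF.uniformOfFinset S hS := by
  classical
  have hcard : S.card = k.val + 1 := by
    have : S = Finset.univ.image e := by ext c; simp [heS]
    rw [this, Finset.card_image_of_injective _ he, Finset.card_univ, Fintype.card_fin]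
  have hfiber : ∀ a, (Finset.univ.filter fun r : Seed n => r k = a).card * (k.val + 1) =
      Fintype.card (Seed n) := by
    intro a
    have h1 : (Finset.univ.filter fun r : Seed n => r k = a) =
        Fintype.piFinset (Function.update (β := fun i : Fin n => Finset (Fin (i.val + 1)))
          (fun _ => Finset.univ) k {a}) := by
      ext r
      simp only [Finset.mem_filter, Finset.mem_univ, true_and, Fintype.mem_piFinset]
      refine ⟨fun h i => ?_, fun h => by simpa using h k⟩
      by_cases hi : i = k
      · subst hi; simp [h]
      · simp [Function.update_of_ne hi]
    rw [h1, Fintype.card_piFinset, Fintype.card_pi, ← Finset.prod_erase_mul _ _ (Finset.mem_univ k),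
      ← Finset.prod_erase_mul Finset.univ (fun i : Fin n => Fintype.card (Fin (i.val + 1)))
        (Finset.mem_univ k), Function.update_self, Finset.card_singleton, mul_one,
      Fintype.card_fin]
    congr 1
    refine Finset.prod_congr rfl fun i hi => ?_
    rw [Function.update_of_ne (Finset.ne_of_mem_erase hi), Finset.card_univ]
  ext c
  rw [PMF.map_apply, tsum_fintype, PMF.uniformOfFinset_apply]
  simp only [PMF.uniformOfFintype_apply]
  rw [← Finset.sum_filter, Finset.sum_const, nsmul_eq_mul]
  split_ifs with hc
  · obtain ⟨a, rfl⟩ := (heS c).1 hc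
    have h1 : (Finset.univ.filter fun r : Seed n => e a = e (r k)) =
        Finset.univ.filter fun r : Seed n => r k = a := by
      ext r; simp [he.eq_iff, eq_comm]
    have h2 := hfiber a
    have h3 : 0 < Fintype.card (Seed n) := Fintype.card_pos
    have h4 : (Finset.univ.filter fun r : Seed n => r k = a).card ≠ 0 := by
      intro h; rw [h, zero_mul] at h2; omega
    rw [h1, ← h2, hcard, Nat.cast_mul, ENNReal.mul_inv (by simp) (by simp), ← mul_assoc,
      ENNReal.mul_inv_cancel (by exact_mod_cast h4) (by simp), one_mul]
  · rw [Finset.filter_false_of_mem, Finset.card_empty, Nat.cast_zero, zero_mul]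
    rintro r - rfl
    exact hc ((heS _).2 ⟨_, rfl⟩)

/-- The program of the Move-to-the-Back Dealer. -/
def progDealer : Prog :=
  .seq progLog (.seq (progDivisor 22) (.seq progLength (.seq progFirst (.seq progEpoch
    (.seq progDraws (.seq progGuesses (.seq progCount progFind)))))))

variable {n : ℕ}

/-- The past guesses, as an array of the input. -/
def guessArray (h : Transcript n) (i : ℕ) : ℕ := (h[i]?).elim 0 fun p => p.1.val

/-- The past draws, as an array of the input. -/
def drawArray (h : Transcript n) (i : ℕ) : ℕ := (h[i]?).elim 0 fun p => p.2.val

/-- The marks that the program makes: it marks the cards outside of `mtbChoices`. -/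
noncomputable def dealerMarks (m : ℕ) (h : Transcript n) : ℕ → ℕ :=
  markLast h.length (guessArray h) (markLast h.length (drawArray h) (fun _ => 0) h.length)
    (h.length - epochStart n m h.length)

theorem epochStart_le (n m T : ℕ) : epochStart n m T ≤ T := by
  rw [epochStart]; split_ifs <;> omega

theorem dealerMarks_eq_zero_iff (m : ℕ) (h : Transcript n) (hn : h.length ≤ n) (j : ℕ) :
    dealerMarks m h j = 0 ↔ ∀ hj : j < n, (⟨j, hj⟩ : Fin n) ∈ mtbChoices n m h := by
  have hs := epochStart_le n m h.length
  rw [dealerMarks, markLast_eq_zero_iff _ _ _ _ _ (by omega),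
    markLast_eq_zero_iff _ _ _ _ _ le_rfl, mtbChoices_eq h hn]
  simp only [true_and, Finset.mem_filter, Finset.mem_univ, Nat.sub_self, zero_le, forall_true_left,
    show h.length - (h.length - epochStart n m h.length) = epochStart n m h.length by omega]
  constructor
  · rintro ⟨h1, h2⟩ hj
    constructor
    · intro hc
      obtain ⟨p, hp, hpc⟩ := List.mem_map.1 hc
      obtain ⟨i, hi, rfl⟩ := List.mem_iff_getElem.1 hp
      exact h1 i hi (by simp [drawArray, hi, hpc])
    · intro hc
      obtain ⟨p, hp, hpc⟩ := List.mem_map.1 hc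
      obtain ⟨i, hi, rfl⟩ := List.mem_iff_getElem.1 hp
      rw [List.length_drop] at hi
      rw [List.getElem_drop] at hpc
      have hi' : epochStart n m h.length + i < h.length := by omega
      exact h2 _ (Nat.le_add_right _ i) hi' (by simp [guessArray, hi', hpc])
  · intro H
    constructor
    · rintro i hi rfl
      have e1 : drawArray h i = (h[i]).2.val := by simp [drawArray, hi]
      refine (H (e1 ▸ (h[i]).2.isLt)).1 (List.mem_map.2 ⟨h[i], List.getElem_mem hi, ?_⟩)
      exact Fin.ext e1.symm
    · rintro i hi1 hi rfl
      have e1 : guessArray h i = (h[i]).1.val := by simp [guessArray, hi]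
      refine (H (e1 ▸ (h[i]).1.isLt)).2 (List.mem_map.2 ⟨h[i], ?_, Fin.ext e1.symm⟩)
      refine List.mem_iff_getElem.2
        ⟨i - epochStart n m h.length, by rw [List.length_drop]; omega, ?_⟩
      rw [List.getElem_drop]
      congr 1
      omega

theorem inputMem_eq_ram (m : ℕ) (h : Transcript n) (r : Seed n) :
    inputMem n m h r = ram (inputMem n m h r).arr
      ([n, m, h.length, 0, 0, 0, 0, 0, 0, 0, 0, 0], fun _ => 0) := by
  unfold ram
  generalize hM : inputMem n m h r = M
  obtain ⟨v, a⟩ := M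
  simp only [inputMem, Mem.mk.injEq] at hM ⊢
  obtain ⟨rfl, rfl⟩ := hM
  constructor
  · funext x
    match x with
    | 0 | 1 | 2 | 3 | 4 | 5 | 6 | 7 | 8 | 9 | 10 | 11 => rfl
    | x + 12 => rfl
  · funext b i
    match b with
    | 0 | 1 | 2 | 3 => rfl
    | b + 4 => simp

/-- The program outputs the card that is not marked and has `r` such cards below it, where `r` is
the random number for the number of cards that are not marked. -/
theorem runs_progDealer (m : ℕ) (hm : m ≤ n) (h : Transcript n) (hn : h.length < n)
    (r : Seed n) {c : ℕ} (hc : c < n) (hmark : dealerMarks m h c = 0)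
    (hr : Nat.count (fun j => dealerMarks m h j = 0) c =
      (inputMem n m h r).arr 2 (Nat.count (fun j => dealerMarks m h j = 0) n - 1)) :
    ∃ τ, Runs progDealer (inputMem n m h r) (40 * n + 200) τ ∧ τ.var 0 = c := by
  set I := (inputMem n m h r).arr with hI
  set len := h.length
  set L := Nat.clog 2 n
  have hk : n / (22 * L) = firstEpoch n := by rw [firstEpoch, ceil_eight_mul_exp_one]
  have hkn : firstEpoch n ≤ n := Nat.div_le_self _ _
  have hx : (if 2 * epochLength n m < n - len ∧ n - len ≤ firstEpoch n ∧ 0 < epochLength n m then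
      (firstEpoch n - (n - len)) % epochLength n m else 0) = len - epochStart n m len := by
    rw [epochStart]
    split_ifs
    · have := Nat.mod_le (firstEpoch n - (n - len)) (epochLength n m)
      omega
    · omega
  have hs := epochStart_le n m len
  have h5 := runs_progEpoch I n m len L (22 * L) (firstEpoch n) (epochLength n m) (fun _ => 0)
  rw [hx] at h5
  have h4 := runs_progFirst I n m len L (22 * L) (epochLength n m) (fun _ => 0)
  rw [hk] at h4
  have hrun := (runs_progLog I n m len (fun _ => 0)).seq
    ((runs_progDivisor I n m len 22 L (2 ^ L) (fun _ => 0)).seq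
    ((runs_progLength I n m len L (22 * L) (fun _ => 0)).seq (h4.seq (h5.seq
    ((runs_progDraws I n m len L (22 * L) (firstEpoch n) (epochLength n m) (n - len)
      (len - epochStart n m len) (fun _ => 0)).seq
    ((runs_progGuesses I n m len L (22 * L) (firstEpoch n) (epochLength n m) (n - len)
      (len - epochStart n m len) (markLast len (I 1) (fun _ => 0) len)).seq
    ((runs_progCount I n m len L (22 * L) (firstEpoch n) (epochLength n m)
      (len - (len - epochStart n m len)) (n - len) (dealerMarks m h)).seq
    (runs_progFind I n m len L (22 * L) (firstEpoch n) (epochLength n m) _ c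
      (dealerMarks m h) hmark hr))))))))
  rw [inputMem_eq_ram]
  exact ⟨_, hrun.mono (by omega), rfl⟩

theorem efficient_mtbDealer : Efficient mtbDealer := by
  refine ⟨progDealer, Polynomial.C 40 * Polynomial.X + Polynomial.C 200, ?_⟩
  intro n m _ hm h hn _
  set S := mtbChoices n m h with hSdef
  have hS : S.Nonempty := (mtbChoices_spec h hn).2
  have hp : ∀ c : Fin n, dealerMarks m h c.val = 0 ↔ c ∈ S := fun c => by
    rw [dealerMarks_eq_zero_iff m h hn.le]
    exact ⟨fun H => H c.isLt, fun H _ => H⟩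
  set q := Nat.count (fun j => dealerMarks m h j = 0) n with hq
  have hlt : ∀ c ∈ S, Nat.count (fun j => dealerMarks m h j = 0) c.val < q := fun c hc =>
    Nat.count_strict_mono ((hp c).2 hc) c.isLt
  have hq0 : 0 < q := let ⟨c, hc⟩ := hS; Nat.zero_lt_of_lt (hlt c hc)
  have hqn : q ≤ n := Nat.count_le _
  have hinf : (Set.ofPred fun j => dealerMarks m h j = 0).Infinite := by
    refine Set.infinite_of_forall_exists_gt fun a => ⟨max n (a + 1), ?_, by omega⟩
    exact (dealerMarks_eq_zero_iff m h hn.le _).2 fun hj => by omega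
  have hnth : ∀ a : Fin (q - 1 + 1), Nat.nth (fun j => dealerMarks m h j = 0) a.val < n :=
    fun a => Nat.nth_lt_of_lt_count (by have := a.isLt; omega)
  have hcount : ∀ a, Nat.count (fun j => dealerMarks m h j = 0)
      (Nat.nth (fun j => dealerMarks m h j = 0) a) = a := Nat.count_nth_of_infinite hinf
  set e : Fin (q - 1 + 1) → Fin n := fun a => ⟨_, hnth a⟩ with he
  set k : Fin n := ⟨q - 1, by omega⟩ with hk
  refine ⟨fun r => e (r k), fun r => ?_, ?_⟩
  · obtain ⟨τ, ⟨T, hT, hexec⟩, hτ⟩ := runs_progDealer m hm h hn r (hnth (r k))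
      (Nat.nth_mem_of_infinite hinf _) (by
        rw [hcount]
        show _ = if hi : q - 1 < n then (r ⟨q - 1, hi⟩).val else 0
        rw [dif_pos (by omega)])
    refine ⟨T, τ, hexec, ?_, hτ⟩
    simpa using hT
  · have hdraw : (mtbDealer n m).draw h = PMF.uniformOfFinset S hS := dif_pos hS
    rw [hdraw]
    refine map_uniformOfFintype_seed k S hS e (fun a b hab => ?_) fun c => ⟨fun hc => ?_, ?_⟩
    · exact Fin.ext (Nat.nth_injective hinf (congrArg Fin.val hab))
    · refine ⟨⟨Nat.count (fun j => dealerMarks m h j = 0) c.val, ?_⟩, Fin.ext ?_⟩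
      · have := hlt c hc
        show _ < q - 1 + 1
        omega
      · exact Nat.nth_count ((hp c).2 hc)
    · rintro ⟨a, rfl⟩
      exact (hp _).1 (Nat.nth_mem_of_infinite hinf a.val)

end Efficient

end CardGame

theorem mainTheorem5 :
    CardGame.Efficient CardGame.mtbDealer ∧
    ∃ C : ℝ, ∀ (n m : ℕ) [NeZero n], 2 ≤ n → 1 ≤ m → m ≤ n →
      ∀ (Ω : Type*) [MeasurableSpace Ω] (P : MeasureTheory.Measure Ω)
        [MeasureTheory.IsProbabilityMeasure P] (G : CardGame.Guesser Ω n m),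
        CardGame.expectedCorrect P (CardGame.mtbDealer n m) G ≤
          ENNReal.ofReal (Real.log m + 2 * Real.log (Real.logb 2 n) + C) := by
  exact ⟨CardGame.efficient_mtbDealer, 9 + Real.log 22, fun n m _ hn hm _ Ω _ P _ G =>
    CardGame.expectedCorrect_mtbDealer_le hn hm P G⟩
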